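/- **Conventions.** A signature consists of function and predicate symbols with arities, together with equality, and is effectively coded; two signatures are disjoint if they share only equality. A theory $T$ over a signature is given by a set of sentences (axioms); a $T$-interpretation is a structure satisfying all axioms, together with values for countably many variables. A formula is $T$-satisfiable if some $T$-interpretation satisfies it. $T$ is decidable if there is an algorithm deciding, for each quantifier-free formula, whether it is $T$-satisfiable. $T$ is stably infinite if every $T$-satisfiable quantifier-free formula is satisfied by a $T$-interpretation with an infinite domain. For theories $T_1,T_2$ over disjoint signatures, $T_1\oplus T_2$ is the theory over the union of the signatures whose axioms are those of $T_1$ together with those of $T_2$. Let $\mathbb N^*=\{1,2,\dots\}$. Call $f:\mathbb N^*\to\{0,1\}$ admissible if $f$ is not computable, $f(1)=1$, and for every $k\ge 1$ exactly half of the numbers in $\{1,\dots,2^k\}$ are mapped by $f$ to $1$ and the other half to $0$. For $i\in\{0,1\}$ let $f_i(k)=|\{j : 1\le j\le k,\ f(j)=i\}|$. Let $\Sigma_s$ be the signature with one unary function symbol $s$ and no predicate symbol but equality. Let $\psi^{=}_{\ge m}$ (resp. $\psi^{=}_{=m}$) be the sentence saying that at least (resp. exactly) $m$ elements $x$ satisfy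 $s(x)=x$, and $\psi^{\ne}_{\ge m}$, $\psi^{\ne}_{=m}$ the same for $s(x)\neq x$. For an admissible $f$ let $T_f$ be the $\Sigma_s$-theory with the axioms $$\bigl(\psi^{=}_{\ge f_1(k)}\wedge\psi^{\ne}_{\ge f_0(k)}\bigr)\ \vee\ \bigvee_{i=1}^{k}\bigl(\psi^{=}_{=f_1(i)}\wedge\psi^{\ne}_{=f_0(i)}\bigr)\qquad(k\in\mathbb N^*).$$ Let $\Sigma_P$ be the signature with $0$-ary predicate symbols $P_1,P_2,\dots$ and no function symbols, and let $T_=$ be the $\Sigma_P$-theory with the axioms $P_n\to\psi_{=n}$ ($n\in\mathbb N^*$), where $\psi_{=n}$ says that the domain has exactly $n$ elements. Finally let $$\varphi^{=}_{\ge m}=\bigwedge_{1\le i<j\le m}\neg(x_i=x_j)\wedge\bigwedge_{i=1}^m s(x_i)=x_i .$$ **Theorem.** There are decidable theories $T_1$ and $T_2$ over disjoint signatures such that $T_1$ is stably infinite but $T_1\oplus T_2$ is undecidable. Moreover, admissible functions exist, $T_=$ is decidable, and for every admissible $f$: 1. $T_f$ is decidable and stably infinite; 2. for every $n\in\mathbb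 N^*$, the formula $P_{n+1}\wedge\varphi^{=}_{\ge f_1(n)+1}$ is $(T_f\oplus T_=)$-satisfiable if and only if $f(n+1)=1$; 3. $T_f\oplus T_=$ is undecidable. -/

import Mathlib

open FirstOrder FirstOrder.Language

namespace TheoryCombination

/-! ### Satisfiability modulo a theory

Formulas have their free variables among the countably many variables `0, 1, 2, …`, so an
interpretation is a structure together with an assignment `ℕ → M`. All languages below are countable
(they carry an effective coding), hence by the Löwenheim–Skolem theorem restricting domains to `Type`
changes neither the satisfiable formulas nor those satisfiable in an infinite interpretation. -/

/-- The formula `φ` is `T`-satisfiable: some interpretation satisfies all axioms of `T` and `φ`. -/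
def Satisfiable {L : FirstOrder.Language.{0, 0}} (T : L.Theory) (φ : L.Formula ℕ) : Prop :=
  ∃ (M : Type) (_ : L.Structure M) (v : ℕ → M), M ⊨ T ∧ φ.Realize v

/-- `T` is stably infinite: every `T`-satisfiable quantifier-free formula is satisfied by an
infinite `T`-interpretation. -/
def StablyInfinite {L : FirstOrder.Language.{0, 0}} (T : L.Theory) : Prop :=
  ∀ φ : L.Formula ℕ, φ.IsQF → Satisfiable T φ →
    ∃ (M : Type) (_ : L.Structure M) (v : ℕ → M), Infinite M ∧ M ⊨ T ∧ φ.Realize v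

/-- The combination of two theories over disjoint signatures. The union of the disjoint signatures
is the sum `L₁.sum L₂` (equality is a logical symbol), and the axioms are those of both theories. -/
def combine {L₁ L₂ : FirstOrder.Language.{0, 0}} (T₁ : L₁.Theory) (T₂ : L₂.Theory) :
    (L₁.sum L₂).Theory :=
  LHom.sumInl.onTheory T₁ ∪ LHom.sumInr.onTheory T₂

/-! ### Codes of formulas and decidability -/

/-- An effective coding of the symbols of a signature: the symbols of each arity are numbered
injectively, and it is decidable which pairs (arity, number) belong to a symbol. -/
class EffectiveSignature (L : FirstOrder.Language.{0, 0}) where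
  funCode : ∀ n, L.Functions n → ℕ
  relCode : ∀ n, L.Relations n → ℕ
  funCode_injective : ∀ n, Function.Injective (funCode n)
  relCode_injective : ∀ n, Function.Injective (relCode n)
  funCode_computable : ComputablePred fun p : ℕ × ℕ => ∃ g, funCode p.1 g = p.2
  relCode_computable : ComputablePred fun p : ℕ × ℕ => ∃ r, relCode p.1 r = p.2

/-- The Gödel number of a term. -/
def termCode {L : FirstOrder.Language.{0, 0}} [EffectiveSignature L] {α : Type} [Encodable α] :
    L.Term α → ℕ
  | Term.var x => 2 * Encodable.encode x
  | @Term.func _ _ n g ts => 2 * Nat.pair (EffectiveSignature.funCode n g)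
      (Encodable.encode (List.ofFn fun i => termCode (ts i))) + 1

/-- The Gödel number of a formula. -/
def formulaCode {L : FirstOrder.Language.{0, 0}} [EffectiveSignature L] :
    ∀ {n : ℕ}, L.BoundedFormula ℕ n → ℕ
  | _, BoundedFormula.falsum => Nat.pair 0 0
  | _, BoundedFormula.equal t u => Nat.pair 1 (Nat.pair (termCode t) (termCode u))
  | _, @BoundedFormula.rel _ _ _ l r ts => Nat.pair 2 (Nat.pair (EffectiveSignature.relCode l r)
      (Encodable.encode (List.ofFn fun i => termCode (ts i))))
  | _, BoundedFormula.imp φ ψ => Nat.pair 3 (Nat.pair (formulaCode φ) (formulaCode ψ))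
  | _, BoundedFormula.all φ => Nat.pair 4 (formulaCode φ)

/-- `T` is decidable: an algorithm decides, given a quantifier-free formula (by its Gödel number),
whether it is `T`-satisfiable. Nothing is required of the algorithm on other numbers; as the set of
Gödel numbers of quantifier-free formulas is decidable over an effective signature, this is the same
as decidability of the set of Gödel numbers of `T`-satisfiable quantifier-free formulas. -/
def IsDecidable {L : FirstOrder.Language.{0, 0}} [EffectiveSignature L] (T : L.Theory) : Prop :=
  ∃ d : ℕ → Bool, Computable d ∧
    ∀ φ : L.Formula ℕ, φ.IsQF → (d (formulaCode φ) = true ↔ Satisfiable T φ)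

/-- A symbol of the union of two disjoint signatures has code `2c` or `2c + 1`, where `c` is its code
in the first or the second signature. -/
def sumCode {A B : ℕ → Type} (a : ∀ n, A n → ℕ) (b : ∀ n, B n → ℕ) (n : ℕ) : A n ⊕ B n → ℕ
  | Sum.inl x => 2 * a n x
  | Sum.inr y => 2 * b n y + 1

theorem sumCode_injective {A B : ℕ → Type} {a : ∀ n, A n → ℕ} {b : ∀ n, B n → ℕ} (n : ℕ)
    (ha : Function.Injective (a n)) (hb : Function.Injective (b n)) :
    Function.Injective (sumCode a b n) := by
  rintro (x | x) (y | y) h <;> simp only [sumCode] at h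
  · rw [ha (show a n x = a n y by omega)]
  · omega
  · omega
  · rw [hb (show b n x = b n y by omega)]

theorem sumCode_computable {A B : ℕ → Type} {a : ∀ n, A n → ℕ} {b : ∀ n, B n → ℕ}
    (ha : ComputablePred fun p : ℕ × ℕ => ∃ x, a p.1 x = p.2)
    (hb : ComputablePred fun p : ℕ × ℕ => ∃ y, b p.1 y = p.2) :
    ComputablePred fun p : ℕ × ℕ => ∃ z, sumCode a b p.1 z = p.2 := by
  classical
  have hdiv : Computable fun p : ℕ × ℕ => (p.1, Nat.div2 p.2) :=
    Computable.fst.pair (Primrec.nat_div2.to_comp.comp Computable.snd)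
  have hodd : Computable fun p : ℕ × ℕ => Nat.bodd p.2 :=
    Primrec.nat_bodd.to_comp.comp Computable.snd
  have hc := Computable.cond hodd (hb.decide.comp hdiv) (ha.decide.comp hdiv)
  refine Computable.computablePred (hc.of_eq ?_)
  rintro ⟨n, c⟩
  have h2 := Nat.bodd_add_div2 c
  cases hb' : Nat.bodd c <;> simp only [hb', cond_true, cond_false, Bool.toNat_true,
      Bool.toNat_false] at h2 ⊢ <;> refine decide_eq_decide.2 ⟨?_, ?_⟩
  · rintro ⟨x, hx⟩
    exact ⟨Sum.inl x, by simp only [sumCode]; omega⟩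
  · rintro ⟨x | y, hz⟩ <;> simp only [sumCode] at hz
    · exact ⟨x, by omega⟩
    · omega
  · rintro ⟨y, hy⟩
    exact ⟨Sum.inr y, by simp only [sumCode]; omega⟩
  · rintro ⟨x | y, hz⟩ <;> simp only [sumCode] at hz
    · omega
    · exact ⟨y, by omega⟩

instance (L₁ L₂ : FirstOrder.Language.{0, 0}) [EffectiveSignature L₁] [EffectiveSignature L₂] :
    EffectiveSignature (L₁.sum L₂) where
  funCode := sumCode (EffectiveSignature.funCode (L := L₁)) (EffectiveSignature.funCode (L := L₂))
  relCode := sumCode (EffectiveSignature.relCode (L := L₁)) (EffectiveSignature.relCode (L := L₂))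
  funCode_injective n := sumCode_injective n (EffectiveSignature.funCode_injective n)
    (EffectiveSignature.funCode_injective n)
  relCode_injective n := sumCode_injective n (EffectiveSignature.relCode_injective n)
    (EffectiveSignature.relCode_injective n)
  funCode_computable := sumCode_computable EffectiveSignature.funCode_computable
    EffectiveSignature.funCode_computable
  relCode_computable := sumCode_computable EffectiveSignature.relCode_computable
    EffectiveSignature.relCode_computable

/-! ### The two signatures -/

/-- The only function symbol is the unary `s`. -/
inductive SFun : ℕ → Type
  | s : SFun 1

/-- The predicate symbols are the nullary `P 1, P 2, …`. -/
inductive PRel : ℕ → Type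
  | P (n : ℕ+) : PRel 0

/-- The signature with a unary function symbol `s` and no predicate symbol but equality. -/
def sigS : FirstOrder.Language.{0, 0} := ⟨SFun, fun _ => Empty⟩

/-- The signature with nullary predicate symbols `P 1, P 2, …` and no function symbols. -/
def sigP : FirstOrder.Language.{0, 0} := ⟨fun _ => Empty, PRel⟩

instance : EffectiveSignature sigS where
  funCode _ _ := 0
  relCode _ r := Empty.elim r
  funCode_injective := by rintro _ ⟨⟩ ⟨⟩ _; rfl
  relCode_injective _ r := Empty.elim r
  funCode_computable := by
    have h : PrimrecPred fun p : ℕ × ℕ => p = (1, 0) :=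
      Primrec.eq.comp Primrec.id (Primrec.const (1, 0))
    refine h.computablePred.of_eq ?_
    rintro ⟨n, c⟩
    constructor
    · rintro ⟨⟩
      exact ⟨SFun.s, rfl⟩
    · rintro ⟨⟨⟩, h⟩
      simpa using h.symm
  relCode_computable := by
    refine ComputablePred.of_eq (p := fun _ => False)
      (Computable.computablePred (Computable.const false)) ?_
    rintro ⟨n, c⟩
    exact ⟨False.elim, fun ⟨r, _⟩ => Empty.elim r⟩

instance : EffectiveSignature sigP where
  funCode _ g := Empty.elim g
  relCode | _, PRel.P n => n.natPred
  funCode_injective _ g := Empty.elim g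
  relCode_injective := by
    rintro _ ⟨m⟩ ⟨n⟩ h
    rw [PNat.natPred_injective h]
  funCode_computable := by
    refine ComputablePred.of_eq (p := fun _ => False)
      (Computable.computablePred (Computable.const false)) ?_
    rintro ⟨n, c⟩
    exact ⟨False.elim, fun ⟨r, _⟩ => Empty.elim r⟩
  relCode_computable := by
    have h : PrimrecPred fun p : ℕ × ℕ => p.1 = 0 :=
      Primrec.eq.comp Primrec.fst (Primrec.const 0)
    refine h.computablePred.of_eq ?_
    rintro ⟨n, c⟩
    constructor
    · rintro h
      obtain rfl : n = 0 := h
      exact ⟨PRel.P c.succPNat, Nat.natPred_succPNat c⟩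
    · rintro ⟨⟨m⟩, _⟩
      rfl

/-! ### Formulas -/

section Formulas

variable {L : FirstOrder.Language.{0, 0}} {α : Type} {n : ℕ}

/-- The conjunction of a finite list of formulas. -/
def conj (l : List (L.BoundedFormula α n)) : L.BoundedFormula α n := l.foldr (· ⊓ ·) ⊤

/-- The disjunction of a finite list of formulas. -/
def disj (l : List (L.BoundedFormula α n)) : L.BoundedFormula α n := l.foldr (· ⊔ ·) ⊥

/-- The conjunction of `¬ (t i = t j)` over all `i < j < m`. -/
def distinct {m : ℕ} (t : Fin m → L.Term (α ⊕ Fin n)) : L.BoundedFormula α n :=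
  conj (((List.finRange m ×ˢ List.finRange m).filter fun ij => ij.1 < ij.2).map
    fun ij => ((t ij.1).bdEqual (t ij.2)).not)

/-- The bound variable of index `i`, as a term. -/
def bvar (i : Fin n) : L.Term (Empty ⊕ Fin n) := Term.var (Sum.inr i)

/-- The domain has at least `m` elements: `∃ x₁ … xₘ, ⋀_{i<j} xᵢ ≠ xⱼ`. -/
def psiGe (L : FirstOrder.Language.{0, 0}) (m : ℕ) : L.Sentence :=
  (distinct (L := L) (n := m) bvar).exs

/-- The domain has at most `m` elements: `∃ x₁ … xₘ, ∀ y, ⋁ᵢ y = xᵢ`. -/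
def psiLe (L : FirstOrder.Language.{0, 0}) (m : ℕ) : L.Sentence :=
  ((disj ((List.finRange m).map fun i : Fin m =>
    (bvar (L := L) (Fin.last m)).bdEqual (bvar i.castSucc))).all).exs

/-- The domain has exactly `m` elements. -/
def psiEq (L : FirstOrder.Language.{0, 0}) (m : ℕ) : L.Sentence := psiGe L m ⊓ psiLe L m

end Formulas

/-- The term `s(t)`. -/
def sTerm {β : Type} (t : sigS.Term β) : sigS.Term β :=
  Functions.apply₁ (L := sigS) SFun.s t

/-- For `b = true`, the formula `s(t) = t`; for `b = false`, its negation. -/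
def fixLit {α : Type} {n : ℕ} (b : Bool) (t : sigS.Term (α ⊕ Fin n)) : sigS.BoundedFormula α n :=
  if b then (sTerm t).bdEqual t else ((sTerm t).bdEqual t).not

/-- There are at least `m` elements `x` with `s(x) = x` (for `b = true`), respectively with
`s(x) ≠ x` (for `b = false`). -/
def psiFixGe (b : Bool) (m : ℕ) : sigS.Sentence :=
  (distinct bvar ⊓ conj ((List.finRange m).map fun i => fixLit b (bvar i))).exs

/-- There are exactly `m` elements `x` with `s(x) = x` (for `b = true`), respectively with
`s(x) ≠ x` (for `b = false`). -/
def psiFixEq (b : Bool) (m : ℕ) : sigS.Sentence :=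
  (distinct bvar ⊓ conj ((List.finRange m).map fun i => fixLit b (bvar i)) ⊓
    ((fixLit b (bvar (Fin.last m))).imp (disj ((List.finRange m).map fun i : Fin m =>
      (bvar (Fin.last m)).bdEqual (bvar i.castSucc)))).all).exs

/-- The quantifier-free formula `⋀_{i<j} xᵢ ≠ xⱼ ∧ ⋀ᵢ s(xᵢ) = xᵢ` in `m` free variables. -/
def phiFixGe (m : ℕ) : sigS.Formula ℕ :=
  distinct (fun i : Fin m => Term.var (Sum.inl (i : ℕ))) ⊓
    conj ((List.finRange m).map fun i => fixLit true (Term.var (Sum.inl (i : ℕ))))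

/-- The atomic formula `P n`. -/
def atomP {α : Type} (n : ℕ+) : sigP.Formula α :=
  Relations.formula (L := sigP) (PRel.P n) Fin.elim0

/-! ### The two theories -/

/-- The number of `j` with `1 ≤ j ≤ k` and `f j = i`. -/
def countVal (f : ℕ+ → Fin 2) (i : Fin 2) (k : ℕ+) : ℕ :=
  ((Finset.Icc 1 k).filter fun j => f j = i).card

/-- `f` is not computable, `f 1 = 1`, and for every `k ≥ 1` half of the numbers between `1` and
`2 ^ k` are mapped to `1`, the other half to `0`. -/
structure Admissible (f : ℕ+ → Fin 2) : Prop where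
  not_computable : ¬ Computable fun n : ℕ => f n.succPNat
  map_one : f 1 = 1
  balanced : ∀ k : ℕ, 1 ≤ k → ∀ i : Fin 2, 2 * countVal f i (2 ^ k) = 2 ^ k

/-- The theory `T_f`, with one axiom for each `k ≥ 1`: either at least `f₁(k)` elements are fixed by
`s` and at least `f₀(k)` are not, or for some `1 ≤ i ≤ k` exactly `f₁(i)` elements are fixed by `s`
and exactly `f₀(i)` are not. -/
def theoryF (f : ℕ+ → Fin 2) : sigS.Theory :=
  Set.range fun k : ℕ+ =>
    (psiFixGe true (countVal f 1 k) ⊓ psiFixGe false (countVal f 0 k)) ⊔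
      disj ((List.range k).map fun j =>
        psiFixEq true (countVal f 1 j.succPNat) ⊓ psiFixEq false (countVal f 0 j.succPNat))

/-- The theory `T_=`, with the axiom `P n → ψ_{= n}` for each `n ≥ 1`. -/
def theoryEq : sigP.Theory :=
  Set.range fun n : ℕ+ => (atomP n).imp (psiEq sigP n)

/-- The formula `P_{n+1} ∧ φ^=_{≥ f₁(n)+1}` over the union of the two signatures. -/
def testFormula (f : ℕ+ → Fin 2) (n : ℕ+) : (sigS.sum sigP).Formula ℕ :=
  LHom.sumInr.onFormula (atomP (n + 1)) ⊓ LHom.sumInl.onFormula (phiFixGe (countVal f 1 n + 1))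

end TheoryCombination

open TheoryCombination

/-! A finite model of $T_f$ with $k$ elements has exactly $f_1(k)$ fixed points
(`encard_fixSet_of_card_eq`), so its finite models record $f$; but a quantifier-free formula over
$\Sigma_s$ alone cannot force a model to be finite. Any structure for $s$ embeds into one with
infinitely many fixed and infinitely many non-fixed points, which satisfies every axiom of $T_f$ by
the first disjunct (`exists_infinite_model_theoryF`). Hence $T_f$ is stably infinite, and
$T_f$-satisfiability of quantifier-free formulas is plain satisfiability, whatever $f$ is.

Plain satisfiability is decidable by bounded search (`searchS_iff`): a formula with Gödel number $g$
mentions only terms of smaller code, so only finitely many values matter, and a table on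
$\{0,\dots,g\}$ records them. $T_=$ is treated alike (`searchP_iff`), the only new point being that
a true $P_n$ fixes the size of the domain.

In the combination, $P_{n+1}$ forces size $n+1$, hence $f_1(n+1)$ fixed points, and asking for
$f_1(n)+1$ of them asks whether $f(n+1)=1$ (`satisfiable_testFormula_iff`). The Gödel number of this
question is computable from $n$ and $f_1(n)$, so a decision procedure would yield $f_1$ and $f$ by
recursion (`not_isDecidable_combine`). An admissible $f$ is obtained by hiding the halting problem
in the order of the values on consecutive pairs (`exists_admissible`). -/

namespace TheoryCombination

/-! ### Semantics of finite conjunctions and disjunctions -/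

section Semantics

variable {L : FirstOrder.Language.{0, 0}} {α M : Type} [L.Structure M] {n : ℕ}

theorem realize_conj (l : List (L.BoundedFormula α n)) (v : α → M) (xs : Fin n → M) :
    (conj l).Realize v xs ↔ ∀ φ ∈ l, φ.Realize v xs :=
  BoundedFormula.realize_foldr_inf l v xs

theorem realize_disj (l : List (L.BoundedFormula α n)) (v : α → M) (xs : Fin n → M) :
    (disj l).Realize v xs ↔ ∃ φ ∈ l, φ.Realize v xs :=
  BoundedFormula.realize_foldr_sup l v xs

theorem realize_distinct {m : ℕ} (t : Fin m → L.Term (α ⊕ Fin n)) (v : α → M) (xs : Fin n → M) :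
    (distinct t).Realize v xs ↔
      Function.Injective fun i => (t i).realize (Sum.elim v xs) := by
  simp only [distinct, realize_conj, List.mem_map, List.mem_filter, List.mem_product,
    List.mem_finRange, true_and, decide_eq_true_eq, Prod.exists, forall_exists_index, and_imp]
  constructor
  · intro h i j hij
    by_contra hne
    rcases lt_or_gt_of_ne hne with hlt | hlt
    · exact h _ i j hlt rfl (by simpa using hij)
    · exact h _ j i hlt rfl (by simpa using hij.symm)
  · rintro h _ i j hlt rfl
    simpa using fun e => hlt.ne (h e)

@[simp] theorem realize_bvar (i : Fin n) (v : Empty → M) (xs : Fin n → M) :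
    (bvar (L := L) i).realize (Sum.elim v xs) = xs i := rfl

end Semantics

/-! ### Cardinality of a definable set through enumerations -/

section Encard

variable {M : Type} {p : M → Prop} {m : ℕ}

theorem exists_injective_iff_le_encard :
    (∃ xs : Fin m → M, Function.Injective xs ∧ ∀ i, p (xs i)) ↔
      (m : ℕ∞) ≤ Set.encard {x | p x} := by
  constructor
  · rintro ⟨xs, hi, hp⟩
    have h : Set.range xs ⊆ {x | p x} := by rintro _ ⟨i, rfl⟩; exact hp i
    refine le_trans (le_of_eq ?_) (Set.encard_le_encard h)
    rw [← Set.image_univ, hi.encard_image, Set.encard_univ, ENat.card_eq_coe_fintype_card,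
      Fintype.card_fin]
  · intro h
    obtain ⟨t, ht, hc⟩ := Set.exists_subset_encard_eq h
    have hfin : t.Finite := Set.finite_of_encard_eq_coe hc
    have := hfin.fintype
    have hcard : Fintype.card t = m := by
      rw [Set.encard_eq_coe_toFinset_card, Set.toFinset_card] at hc
      exact_mod_cast hc
    let e := Fintype.equivFinOfCardEq hcard
    exact ⟨fun i => (e.symm i : M), Subtype.val_injective.comp e.symm.injective,
      fun i => ht (e.symm i).2⟩

theorem exists_enumeration_iff_encard_eq :
    (∃ xs : Fin m → M, (Function.Injective xs ∧ ∀ i, p (xs i)) ∧ ∀ y, p y → ∃ i, y = xs i) ↔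
      Set.encard {x | p x} = m := by
  constructor
  · rintro ⟨xs, ⟨hi, hp⟩, hs⟩
    have h : {x | p x} = Set.range xs := by
      ext y
      refine ⟨fun hy => ?_, ?_⟩
      · obtain ⟨i, rfl⟩ := hs y hy
        exact ⟨i, rfl⟩
      · rintro ⟨i, rfl⟩
        exact hp i
    rw [h, ← Set.image_univ, hi.encard_image, Set.encard_univ, ENat.card_eq_coe_fintype_card,
      Fintype.card_fin]
  · intro h
    obtain ⟨xs, hi, hp⟩ := exists_injective_iff_le_encard.2 h.ge
    refine ⟨xs, ⟨hi, hp⟩, fun y hy => ?_⟩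
    have hsub : Set.range xs ⊆ {x | p x} := by rintro _ ⟨i, rfl⟩; exact hp i
    have heq : Set.range xs = {x | p x} := by
      refine (Set.finite_range xs).eq_of_subset_of_encard_le hsub ?_
      rw [h, ← Set.image_univ, hi.encard_image, Set.encard_univ, ENat.card_eq_coe_fintype_card,
        Fintype.card_fin]
    obtain ⟨i, hi⟩ := heq.ge hy
    exact ⟨i, hi.symm⟩

end Encard

/-! ### What the axioms and formulas say about a structure -/

section Sentences

theorem realize_psiEq {L : FirstOrder.Language.{0, 0}} {M : Type} [L.Structure M] [Nonempty M]
    (m : ℕ) : M ⊨ psiEq L m ↔ ENat.card M = m := by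
  have hge : M ⊨ psiGe L m ↔ (m : ℕ∞) ≤ ENat.card M := by
    rw [← Set.encard_univ, ← Set.ofPred_true, ← exists_injective_iff_le_encard]
    simp only [psiGe, Sentence.Realize, BoundedFormula.realize_exs, realize_distinct, realize_bvar,
      implies_true, and_true]
  have hle : M ⊨ psiLe L m ↔ ∃ xs : Fin m → M, Function.Surjective xs := by
    simp only [psiLe, Sentence.Realize, BoundedFormula.realize_exs, BoundedFormula.realize_all,
      realize_disj, List.mem_map, List.mem_finRange, true_and, exists_exists_eq_and,
      BoundedFormula.realize_bdEqual, realize_bvar, Fin.snoc_last, Fin.snoc_castSucc]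
    exact exists_congr fun xs => forall_congr' fun y => exists_congr fun i => eq_comm
  have hand : M ⊨ psiEq L m ↔ M ⊨ psiGe L m ∧ M ⊨ psiLe L m := by
    simp only [psiEq, Sentence.Realize, Formula.Realize, BoundedFormula.realize_inf]
  rw [hand, hge, hle]
  constructor
  · rintro ⟨h, xs, hs⟩
    refine le_antisymm ?_ h
    have := Finite.of_surjective xs hs
    have h2 := Nat.card_le_card_of_surjective xs hs
    rw [Nat.card_fin] at h2
    rw [ENat.card_eq_coe_natCard]
    exact_mod_cast h2
  · intro h
    have hfin : Finite M := by
      rw [← ENat.card_lt_top, h]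
      exact ENat.natCast_lt_top m
    rw [ENat.card_eq_coe_natCard] at h
    have h' : Nat.card M = m := by exact_mod_cast h
    refine ⟨by rw [ENat.card_eq_coe_natCard, h'], ?_⟩
    exact ⟨(Finite.equivFinOfCardEq h').symm, (Finite.equivFinOfCardEq h').symm.surjective⟩

variable {M : Type} [sigS.Structure M]

/-- The interpretation of the function symbol `s`. -/
def sMap (x : M) : M := Structure.funMap (L := sigS) (M := M) SFun.s ![x]

theorem realize_sTerm {β : Type} (t : sigS.Term β) (v : β → M) :
    (sTerm t).realize v = sMap (t.realize v) :=
  Term.realize_functions_apply₁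

/-- The set of fixed points of `s` (for `b = true`), respectively its complement. -/
def fixSet (M : Type) [sigS.Structure M] (b : Bool) : Set M := {x | sMap x = x ↔ b = true}

theorem realize_fixLit {α : Type} {n : ℕ} (b : Bool) (t : sigS.Term (α ⊕ Fin n)) (v : α → M)
    (xs : Fin n → M) :
    (fixLit b t).Realize v xs ↔ t.realize (Sum.elim v xs) ∈ fixSet M b := by
  cases b <;> simp [fixLit, fixSet, realize_sTerm]

theorem realize_psiFixGe (b : Bool) (m : ℕ) :
    M ⊨ psiFixGe b m ↔ (m : ℕ∞) ≤ (fixSet M b).encard := by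
  rw [← Set.ofPred_mem_eq (s := fixSet M b), ← exists_injective_iff_le_encard]
  simp only [psiFixGe, Sentence.Realize, BoundedFormula.realize_exs, BoundedFormula.realize_inf,
    realize_distinct, realize_conj, List.mem_map, List.mem_finRange, true_and,
    forall_exists_index, forall_apply_eq_imp_iff, realize_fixLit, realize_bvar]

theorem realize_psiFixEq (b : Bool) (m : ℕ) :
    M ⊨ psiFixEq b m ↔ (fixSet M b).encard = m := by
  rw [← Set.ofPred_mem_eq (s := fixSet M b), ← exists_enumeration_iff_encard_eq]
  simp only [psiFixEq, Sentence.Realize, BoundedFormula.realize_exs, BoundedFormula.realize_inf,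
    realize_distinct, realize_conj, realize_disj, List.mem_map, List.mem_finRange, true_and,
    forall_exists_index, forall_apply_eq_imp_iff, realize_fixLit, realize_bvar,
    exists_exists_eq_and, BoundedFormula.realize_all, BoundedFormula.realize_imp,
    BoundedFormula.realize_bdEqual, Fin.snoc_last, Fin.snoc_castSucc]

theorem fixSet_false : fixSet M false = (fixSet M true)ᶜ := by
  ext x
  simp [fixSet]

/-- The index list in the second conjunct of `phiFixGe` is elaborated as a monadic coercion of
`List.finRange m` to a list of naturals; this brings it to usable form. -/
theorem coe_finRange_eq_range (m : ℕ) :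
    (do let a ← List.finRange m; pure (a : ℕ)) = List.range m := by
  rw [← List.map_coe_finRange_eq_range]
  exact List.flatMap_pure_eq_map _ _

theorem realize_phiFixGe (m : ℕ) (v : ℕ → M) :
    (phiFixGe m).Realize v ↔
      Function.Injective (fun i : Fin m => v i) ∧ ∀ i : Fin m, v i ∈ fixSet M true := by
  simp only [phiFixGe, coe_finRange_eq_range, Formula.Realize, BoundedFormula.realize_inf,
    realize_distinct, realize_conj, List.mem_map, List.mem_range, forall_exists_index, and_imp,
    forall_apply_eq_imp_iff₂, realize_fixLit, Term.realize_var, Sum.elim_inl, Fin.forall_iff]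

theorem realize_atomP {M : Type} [sigP.Structure M] {α : Type} (n : ℕ+) (v : α → M) :
    (atomP n).Realize v ↔ Structure.RelMap (L := sigP) (M := M) (PRel.P n) Fin.elim0 := by
  refine Formula.realize_rel.trans ?_
  exact iff_of_eq (congrArg _ (funext fun i => i.elim0))

theorem model_theoryEq_iff {M : Type} [sigP.Structure M] [Nonempty M] :
    M ⊨ theoryEq ↔ ∀ n : ℕ+, Structure.RelMap (L := sigP) (M := M) (PRel.P n) Fin.elim0 →
      ENat.card M = (n : ℕ) := by
  simp only [theoryEq, Theory.model_iff, Set.forall_mem_range]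
  refine forall_congr' fun n => ?_
  rw [← realize_psiEq (L := sigP), ← realize_atomP (α := Empty) n default]
  exact BoundedFormula.realize_imp

theorem model_theoryF_iff (f : ℕ+ → Fin 2) :
    M ⊨ theoryF f ↔ ∀ k : ℕ+,
      ((countVal f 1 k : ℕ∞) ≤ (fixSet M true).encard ∧
        (countVal f 0 k : ℕ∞) ≤ (fixSet M false).encard) ∨
      ∃ j ≤ k, (fixSet M true).encard = countVal f 1 j ∧
        (fixSet M false).encard = countVal f 0 j := by
  simp only [theoryF, Theory.model_iff, Set.forall_mem_range]
  refine forall_congr' fun k => ?_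
  simp only [← realize_psiFixGe, ← realize_psiFixEq]
  simp only [Sentence.Realize, Formula.Realize, BoundedFormula.realize_sup,
    BoundedFormula.realize_inf, realize_disj, List.mem_map, List.mem_range,
    exists_exists_and_eq_and]
  refine or_congr Iff.rfl ⟨?_, ?_⟩
  · rintro ⟨a, ha, h⟩
    exact ⟨a.succPNat, by rw [← PNat.coe_le_coe, Nat.succPNat_coe]; omega, h⟩
  · rintro ⟨j, hj, h⟩
    refine ⟨j.natPred, ?_, ?_⟩
    · rw [← PNat.coe_le_coe, ← PNat.natPred_add_one j] at hj
      omega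
    · rwa [PNat.succPNat_natPred]

end Sentences

/-! ### The counting functions $f_0$ and $f_1$ -/

section Counting

variable (f : ℕ+ → Fin 2) (i : Fin 2)

theorem countVal_one : countVal f i 1 = if f 1 = i then 1 else 0 := by
  have : Finset.Icc (1 : ℕ+) 1 = {1} := Finset.Icc_self 1
  rw [countVal, this, Finset.filter_singleton]
  split_ifs <;> rfl

theorem countVal_add_one (k : ℕ+) :
    countVal f i (k + 1) = countVal f i k + if f (k + 1) = i then 1 else 0 := by
  have h : Finset.Icc 1 (k + 1) = insert (k + 1) (Finset.Icc 1 k) := by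
    ext j
    simp only [Finset.mem_Icc, Finset.mem_insert, ← PNat.coe_le_coe, ← PNat.coe_inj, PNat.add_coe,
      PNat.one_coe]
    have := j.pos
    omega
  have hn : k + 1 ∉ (Finset.Icc 1 k).filter fun j => f j = i := by
    simp
  rw [countVal, h, Finset.filter_insert, countVal]
  split_ifs
  · rw [Finset.card_insert_of_notMem hn]
  · rfl

theorem countVal_mono {k l : ℕ+} (h : k ≤ l) : countVal f i k ≤ countVal f i l :=
  Finset.card_le_card (Finset.filter_subset_filter _ (Finset.Icc_subset_Icc_right h))

theorem countVal_one_add_countVal_zero (k : ℕ+) : countVal f 1 k + countVal f 0 k = k := by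
  have h : ∀ j, f j = 0 ↔ ¬ f j = 1 := fun j => by omega
  simp only [countVal, h]
  rw [Finset.card_filter_add_card_filter_not, PNat.card_Icc]
  simp

end Counting

/-! ### Evaluating quantifier-free formulas from their Gödel numbers -/

section Evaluation

/-- Evaluates the formula with Gödel number `g`, given the truth values of the atomic formulas. -/
def evalCode (A : ℕ → Bool) (g : ℕ) : Bool :=
  -- Tag 0 is falsity and tag 3 implication. Every other tag goes to `A`, including that of
  -- quantifiers, which does not occur in a quantifier-free formula.
  if g.unpair.1 = 0 then false
  else if h : g.unpair.1 = 3 then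
    have : g.unpair.2 < g := by
      conv_rhs => rw [← Nat.pair_unpair g, h]
      exact lt_of_le_of_lt (Nat.right_le_pair 0 _) (Nat.pair_lt_pair_left _ (by norm_num))
    !(evalCode A g.unpair.2.unpair.1) || evalCode A g.unpair.2.unpair.2
  else A g
termination_by g
decreasing_by
  · exact lt_of_le_of_lt (Nat.unpair_left_le _) this
  · exact lt_of_le_of_lt (Nat.unpair_right_le _) this

theorem lt_pair_left_of_pos {a : ℕ} (ha : 0 < a) (b : ℕ) : b < Nat.pair a b :=
  lt_of_le_of_lt (Nat.right_le_pair 0 b) (Nat.pair_lt_pair_left b ha)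

/-- Course-of-values recursion: `step` receives the list of all earlier values, whose length is the
current argument. The two entries it looks up lie below that argument, so the default of `getD` is
never reached. -/
theorem primrec₂_evalCode {σ : Type} [Primcodable σ] {A : σ → ℕ → Bool} (hA : Primrec₂ A) :
    Primrec₂ fun p g => evalCode (A p) g := by
  let step : σ → List Bool → Option Bool := fun p l =>
    if l.length.unpair.1 = 0 then some false
    else if l.length.unpair.1 = 3 then
      some (!(l.getD l.length.unpair.2.unpair.1 false) || l.getD l.length.unpair.2.unpair.2 false)
    else some (A p l.length)
  have hlen : Primrec fun q : σ × List Bool => q.2.length := Primrec.list_length.comp Primrec.snd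
  have hun : Primrec fun q : σ × List Bool => q.2.length.unpair := Primrec.unpair.comp hlen
  have hun2 : Primrec fun q : σ × List Bool => q.2.length.unpair.2.unpair :=
    Primrec.unpair.comp (Primrec.snd.comp hun)
  have hget : ∀ {h : σ × List Bool → ℕ}, Primrec h →
      Primrec fun q : σ × List Bool => q.2.getD (h q) false := fun hh =>
    (Primrec.list_getD false).comp Primrec.snd hh
  refine Primrec.nat_strong_rec _ (g := step) ?_ ?_
  · refine Primrec.ite (Primrec.eq.comp (Primrec.fst.comp hun) (Primrec.const 0))
      (Primrec.const _) (Primrec.ite (Primrec.eq.comp (Primrec.fst.comp hun) (Primrec.const 3))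
        (Primrec.option_some.comp (Primrec.or.comp (Primrec.not.comp
          (hget (Primrec.fst.comp hun2))) (hget (Primrec.snd.comp hun2))))
        (Primrec.option_some.comp (hA.comp Primrec.fst hlen)))
  · intro p g
    rw [evalCode]
    simp only [step, List.length_map, List.length_range]
    split_ifs with h0 h3
    · rfl
    · have hlt : g.unpair.2 < g := by
        conv_rhs => rw [← Nat.pair_unpair g, h3]
        exact lt_pair_left_of_pos (by norm_num) _
      have h1 : g.unpair.2.unpair.1 < g := lt_of_le_of_lt (Nat.unpair_left_le _) hlt
      have h2 : g.unpair.2.unpair.2 < g := lt_of_le_of_lt (Nat.unpair_right_le _) hlt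
      simp [List.getD, h1, h2]
    · rfl

variable {L : FirstOrder.Language.{0, 0}} [EffectiveSignature L] {M : Type} [L.Structure M]

/-- Subformulas have smaller codes, so `A` need be right only up to the bound `G`. This is why a
finite table can stand in for an arbitrary structure. -/
theorem evalCode_iff {v : ℕ → M} {A : ℕ → Bool} {G : ℕ}
    (hA : ∀ φ : L.Formula ℕ, φ.IsAtomic → formulaCode φ ≤ G →
      (A (formulaCode φ) = true ↔ φ.Realize v))
    {φ : L.Formula ℕ} (hφ : φ.IsQF) (hG : formulaCode φ ≤ G) :
    evalCode A (formulaCode φ) = true ↔ φ.Realize v := by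
  induction hφ with
  | falsum =>
    have h : formulaCode (BoundedFormula.falsum : L.Formula ℕ) = Nat.pair 0 0 := by rw [formulaCode]
    rw [evalCode]
    simp only [h, Nat.unpair_pair]
    exact ⟨fun h => absurd h (by simp), False.elim⟩
  | of_isAtomic h =>
    rw [← hA _ h hG, evalCode]
    cases h with
    | equal t₁ t₂ =>
      have h : (formulaCode (t₁.bdEqual t₂ : L.Formula ℕ)).unpair.1 = 1 := by
        rw [Term.bdEqual, formulaCode, Nat.unpair_pair]
      simp [h]
    | rel R ts =>
      have h : (formulaCode (R.boundedFormula ts : L.Formula ℕ)).unpair.1 = 2 := by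
        rw [Relations.boundedFormula, formulaCode, Nat.unpair_pair]
      simp [h]
  | @imp φ ψ _ _ ih₁ ih₂ =>
    have h : formulaCode (φ.imp ψ) = Nat.pair 3 (Nat.pair (formulaCode φ) (formulaCode ψ)) := by
      rw [formulaCode]
    have hle : Nat.pair (formulaCode φ) (formulaCode ψ) ≤ G :=
      (lt_pair_left_of_pos (by norm_num) _).le.trans (h ▸ hG)
    have h₁ := ih₁ ((Nat.left_le_pair _ _).trans hle)
    have h₂ := ih₂ ((Nat.right_le_pair _ _).trans hle)
    rw [evalCode]
    simp only [h, Nat.unpair_pair, OfNat.ofNat_ne_zero, if_false, dite_true, Bool.or_eq_true,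
      Bool.not_eq_true', Formula.Realize, BoundedFormula.realize_imp] at h₁ h₂ ⊢
    rw [← h₁, ← h₂]
    cases evalCode A (formulaCode φ) <;> simp

end Evaluation

/-! ### Finite tables coded as numbers in base $N$ -/

section Digits

/-- The digit of `c` at position `j` in base `N`. -/
def digit (N c j : ℕ) : ℕ := c / N ^ j % N

theorem primrec_digit {σ : Type} [Primcodable σ] {a b c : σ → ℕ} (ha : Primrec a) (hb : Primrec b)
    (hc : Primrec c) : Primrec fun p => digit (a p) (b p) (c p) :=
  Primrec.nat_mod.comp (Primrec.nat_div.comp hb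
    ((Primrec₂.unpaired'.1 Nat.Primrec.pow).comp ha hc)) ha

theorem digit_lt {N : ℕ} (hN : 0 < N) (c j : ℕ) : digit N c j < N := Nat.mod_lt _ hN

/-- Turns a search over all finite tables into a bounded search over numbers. -/
theorem exists_digits_eq {N B : ℕ} (h : ℕ → ℕ) (hh : ∀ j < B, h j < N) :
    ∃ c < N ^ B, ∀ j < B, digit N c j = h j := by
  let F : Fin B → Fin N := fun j => ⟨h j, hh j j.2⟩
  refine ⟨finFunctionFinEquiv F, (finFunctionFinEquiv F).2, fun j hj => ?_⟩
  have := congrFun (finFunctionFinEquiv.symm_apply_apply F) ⟨j, hj⟩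
  simpa [F, Fin.ext_iff, finFunctionFinEquiv, digit] using this

end Digits

theorem primrecRel_exists_lt {σ : Type} [Primcodable σ] {R : ℕ → σ → Prop} (hR : PrimrecRel R) :
    PrimrecRel fun n p => ∃ x < n, R x p :=
  (hR.exists_mem_list.comp (Primrec.list_range.comp Primrec.fst) Primrec.snd).of_eq (by simp)

/-! ### Deciding plain satisfiability with one unary function -/

section UnaryFunction

/-- The code of the argument of the term `s(t)` with Gödel number `g`. -/
def argCode (g : ℕ) : ℕ := ((g / 2).unpair.2 - 1).unpair.1

theorem argCode_lt {g : ℕ} (h : g % 2 = 1) : argCode g < g := by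
  have h1 := Nat.unpair_left_le ((g / 2).unpair.2 - 1)
  have h2 := Nat.unpair_right_le (g / 2)
  unfold argCode
  omega

/-- The value of the term with Gödel number `g` in the structure with domain `{0, …, N - 1}` in
which `s` is given by the digits of `c` and the assignment by the digits of `d`. -/
def termValue (N c d g : ℕ) : ℕ :=
  if h : g % 2 = 1 then
    have := argCode_lt h
    digit N c (termValue N c d (argCode g))
  else digit N d (g / 2)
termination_by g

theorem primrec₂_termValue :
    Primrec₂ fun (p : ℕ × ℕ × ℕ) (g : ℕ) => termValue p.1 p.2.1 p.2.2 g := by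
  let step : ℕ × ℕ × ℕ → List ℕ → Option ℕ := fun p l =>
    if l.length % 2 = 1 then some (digit p.1 p.2.1 (l.getD (argCode l.length) 0))
    else some (digit p.1 p.2.2 (l.length / 2))
  have hlen : Primrec fun q : (ℕ × ℕ × ℕ) × List ℕ => q.2.length :=
    Primrec.list_length.comp Primrec.snd
  have hdiv := Primrec.nat_div.comp hlen (Primrec.const 2)
  have harg : Primrec fun q : (ℕ × ℕ × ℕ) × List ℕ => argCode q.2.length :=
    Primrec.fst.comp (Primrec.unpair.comp (Primrec.nat_sub.comp
      (Primrec.snd.comp (Primrec.unpair.comp hdiv)) (Primrec.const 1)))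
  have hN : Primrec fun q : (ℕ × ℕ × ℕ) × List ℕ => q.1.1 := Primrec.fst.comp Primrec.fst
  refine Primrec.nat_strong_rec _ (g := step) ?_ ?_
  · exact Primrec.ite (Primrec.eq.comp (Primrec.nat_mod.comp hlen (Primrec.const 2))
      (Primrec.const 1))
      (Primrec.option_some.comp (primrec_digit hN
        (Primrec.fst.comp (Primrec.snd.comp Primrec.fst))
        ((Primrec.list_getD 0).comp Primrec.snd harg)))
      (Primrec.option_some.comp (primrec_digit hN
        (Primrec.snd.comp (Primrec.snd.comp Primrec.fst)) hdiv))
  · intro p g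
    rw [termValue]
    simp only [step, List.length_map, List.length_range]
    split_ifs with h
    · simp [List.getD, argCode_lt h]
    · rfl

/-- The truth value of the atomic formula with Gödel number `g`, which is an equation. -/
def evalAtomS (p : ℕ × ℕ × ℕ) (g : ℕ) : Bool :=
  termValue p.1 p.2.1 p.2.2 g.unpair.2.unpair.1 == termValue p.1 p.2.1 p.2.2 g.unpair.2.unpair.2

theorem primrec₂_evalAtomS : Primrec₂ evalAtomS := by
  have h : Primrec fun q : (ℕ × ℕ × ℕ) × ℕ => q.2.unpair.2.unpair :=
    Primrec.unpair.comp (Primrec.snd.comp (Primrec.unpair.comp Primrec.snd))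
  exact Primrec.beq.comp (primrec₂_termValue.comp Primrec.fst (Primrec.fst.comp h))
    (primrec₂_termValue.comp Primrec.fst (Primrec.snd.comp h))

/-- Some structure of size at most `g + 1` satisfies the formula with Gödel number `g`. -/
def SearchS (g : ℕ) : Prop :=
  ∃ c < (g + 1) ^ (g + 1), ∃ d < (g + 1) ^ (g + 1), evalCode (evalAtomS (g + 1, c, d)) g = true

theorem primrecPred_searchS : PrimrecPred SearchS := by
  have hsucc : Primrec fun g : ℕ => g + 1 := Primrec.succ
  have hpow : Primrec fun g : ℕ => (g + 1) ^ (g + 1) :=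
    (Primrec₂.unpaired'.1 Nat.Primrec.pow).comp hsucc hsucc
  have h0 : Primrec₂ fun (p : ℕ × ℕ × ℕ) (g : ℕ) => evalCode (evalAtomS p) g :=
    primrec₂_evalCode primrec₂_evalAtomS
  have h1 : PrimrecRel fun (d : ℕ) (q : ℕ × ℕ) =>
      evalCode (evalAtomS (q.1 + 1, q.2, d)) q.1 = true := by
    have h : Primrec fun x : ℕ × ℕ × ℕ => evalCode (evalAtomS (x.2.1 + 1, x.2.2, x.1)) x.2.1 :=
      h0.comp ((Primrec.succ.comp (Primrec.fst.comp Primrec.snd)).pair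
        ((Primrec.snd.comp Primrec.snd).pair Primrec.fst)) (Primrec.fst.comp Primrec.snd)
    exact Primrec.eq.comp h (Primrec.const true)
  have h2 : PrimrecRel fun (c g : ℕ) => ∃ d < (g + 1) ^ (g + 1),
      evalCode (evalAtomS (g + 1, c, d)) g = true := by
    have h : PrimrecPred fun q : ℕ × ℕ => ∃ d < (q.2 + 1) ^ (q.2 + 1),
        evalCode (evalAtomS (q.2 + 1, q.1, d)) q.2 = true := by
      have h3 := primrecRel_exists_lt h1
      exact h3.comp (hpow.comp Primrec.snd) (Primrec.snd.pair Primrec.fst)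
    exact h
  exact (primrecRel_exists_lt h2).comp hpow Primrec.id

/-- The symbol `s` has code 0, and a one-element list `[a]` is encoded as `Nat.pair a 0 + 1`; the
subtraction in `argCode` undoes that successor. -/
theorem termCode_sTerm {β : Type} [Encodable β] (t : sigS.Term β) :
    termCode (sTerm t) = 2 * Nat.pair 0 (Nat.pair (termCode t) 0 + 1) + 1 := by
  have : termCode (sTerm t) = 2 * Nat.pair 0 (Encodable.encode (List.ofFn fun i : Fin 1 =>
      termCode ((![t] : Fin 1 → sigS.Term β) i))) + 1 := rfl
  rw [this]
  rfl

theorem termCode_sTerm_mod_two {β : Type} [Encodable β] (t : sigS.Term β) :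
    termCode (sTerm t) % 2 = 1 := by
  rw [termCode_sTerm]
  omega

theorem argCode_termCode_sTerm {β : Type} [Encodable β] (t : sigS.Term β) :
    argCode (termCode (sTerm t)) = termCode t := by
  rw [termCode_sTerm, argCode]
  have : ∀ a, (2 * a + 1) / 2 = a := fun a => by omega
  simp [this]

theorem sTerm_induction {β : Type} {P : sigS.Term β → Prop} (var : ∀ x, P (Term.var x))
    (s : ∀ t, P t → P (sTerm t)) (t : sigS.Term β) : P t := by
  induction t with
  | var x => exact var x
  | func g ts ih =>
    cases g
    have : ts = ![ts 0] := by ext i; fin_cases i; rfl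
    rw [this]
    exact s _ (ih 0)

/-- Needed so that a value can be recovered from the least code of a term denoting it. -/
theorem termCode_injective {β : Type} [Encodable β] :
    Function.Injective (termCode : sigS.Term β → ℕ) := by
  intro t
  induction t using sTerm_induction with
  | var x =>
    intro t' h
    induction t' using sTerm_induction with
    | var y =>
      rw [termCode, termCode] at h
      rw [Encodable.encode_injective (show Encodable.encode x = Encodable.encode y by omega)]
    | s t' _ =>
      have := termCode_sTerm_mod_two t'
      rw [← h, termCode] at this
      omega
  | s t ih =>
    intro t' h
    induction t' using sTerm_induction with
    | var y =>
      have := termCode_sTerm_mod_two t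
      rw [h, termCode] at this
      omega
    | s t' _ =>
      have := congrArg argCode h
      rw [argCode_termCode_sTerm, argCode_termCode_sTerm] at this
      rw [ih this]

/-- Correctness of `termValue`, up to a coding `e` of the values of the terms by numbers. -/
theorem termValue_eq {M : Type} [sigS.Structure M] {v : ℕ → M} {N c d G : ℕ} (e : M → ℕ)
    (hvar : ∀ i, 4 * i < G → digit N d (2 * i) = e (v i))
    (hs : ∀ t : sigS.Term (ℕ ⊕ Fin 0), termCode (sTerm t) < G →
      digit N c (e (t.realize (Sum.elim v default))) =
        e (sMap (t.realize (Sum.elim v default))))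
    (t : sigS.Term (ℕ ⊕ Fin 0)) (ht : termCode t < G) :
    termValue N c d (termCode t) = e (t.realize (Sum.elim v default)) := by
  induction t using sTerm_induction with
  | var x =>
    rcases x with i | i
    · have h : termCode (Term.var (Sum.inl i) : sigS.Term (ℕ ⊕ Fin 0)) = 2 * (2 * i) := by
        rw [termCode, Encodable.encode_inl, Encodable.encode_nat]
      rw [h] at ht ⊢
      rw [termValue, dif_neg (by omega), Nat.mul_div_cancel_left _ (by norm_num),
        hvar i (by omega)]
      rfl
    · exact i.elim0
  | s t ih =>
    have hodd := termCode_sTerm_mod_two t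
    have hlt := argCode_lt hodd
    rw [argCode_termCode_sTerm] at hlt
    rw [termValue, dif_pos hodd]
    simp only [argCode_termCode_sTerm]
    rw [ih (hlt.trans ht), hs t ht, realize_sTerm]

/-- Only the values of terms of code below `G` enter, so `e` has to separate just these and need not
be injective on `M`. -/
theorem evalAtomS_iff {M : Type} [sigS.Structure M] {v : ℕ → M} {N c d G : ℕ} (e : M → ℕ)
    (he : ∀ t t' : sigS.Term (ℕ ⊕ Fin 0), termCode t < G → termCode t' < G →
      e (t.realize (Sum.elim v default)) = e (t'.realize (Sum.elim v default)) →
      t.realize (Sum.elim v default) = t'.realize (Sum.elim v default))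
    (heval : ∀ t : sigS.Term (ℕ ⊕ Fin 0), termCode t < G →
      termValue N c d (termCode t) = e (t.realize (Sum.elim v default)))
    {φ : sigS.Formula ℕ} (hφ : φ.IsAtomic) (hG : formulaCode φ < G) :
    evalAtomS (N, c, d) (formulaCode φ) = true ↔ φ.Realize v := by
  cases hφ with
  | equal t₁ t₂ =>
    have h : formulaCode (t₁.bdEqual t₂ : sigS.Formula ℕ) =
        Nat.pair 1 (Nat.pair (termCode t₁) (termCode t₂)) := by rw [Term.bdEqual, formulaCode]
    rw [h] at hG ⊢
    have hlt := (lt_pair_left_of_pos one_pos _).trans hG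
    have h₁ := (Nat.left_le_pair _ _).trans_lt hlt
    have h₂ := (Nat.right_le_pair _ _).trans_lt hlt
    simp only [evalAtomS, Nat.unpair_pair, beq_iff_eq, heval _ h₁, heval _ h₂, Formula.Realize,
      BoundedFormula.realize_bdEqual]
    exact ⟨he _ _ h₁ h₂, fun h => congrArg e h⟩
  | rel R ts => exact Empty.elim R

/-- The structure with domain `{0, …, N - 1}` in which `s` is given by the digits of `c`. -/
@[reducible] def digitStructure {N : ℕ} (hN : 0 < N) (c : ℕ) : sigS.Structure (Fin N) where
  funMap := fun {_} g x => match g with | SFun.s => ⟨digit N c (x 0), digit_lt hN _ _⟩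
  RelMap := fun {_} r => Empty.elim r

/-- A successful search is itself a structure on `Fin G`. Conversely, name each term value in a
given structure by the least code of a term denoting it: the name is at most the code of any such
term, so all values relevant to `φ` get names below `G`, and the behaviour of `s` and of the
assignment on names fits into two tables. -/
theorem searchS_iff {φ : sigS.Formula ℕ} (hφ : φ.IsQF) :
    SearchS (formulaCode φ) ↔
      ∃ (M : Type) (_ : sigS.Structure M) (v : ℕ → M), φ.Realize v := by
  set G := formulaCode φ + 1 with hG
  have hG0 : 0 < G := Nat.succ_pos _
  constructor
  · rintro ⟨c, -, d, -, h⟩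
    let inst := digitStructure hG0 c
    refine ⟨Fin G, inst, fun i => ⟨digit G d (2 * i), digit_lt hG0 _ _⟩, ?_⟩
    refine (evalCode_iff (G := formulaCode φ) (fun ψ hψ hle => ?_) hφ le_rfl).1 h
    exact evalAtomS_iff (G := G) (fun x : Fin G => (x : ℕ)) (fun t t' _ _ => Fin.ext)
      (termValue_eq _ (fun i _ => rfl) (fun t _ => rfl)) hψ (by omega)
  · rintro ⟨M, _, v, hv⟩
    classical
    let val (t : sigS.Term (ℕ ⊕ Fin 0)) : M := t.realize (Sum.elim v default)
    let P (x : M) (g : ℕ) : Prop := ∃ t, termCode t = g ∧ val t = x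
    let e (x : M) : ℕ := if h : ∃ g, P x g then Nat.find h else 0
    have he_spec : ∀ t, P (val t) (e (val t)) := fun t => by
      have h : ∃ g, P (val t) g := ⟨_, t, rfl, rfl⟩
      simp only [e, dif_pos h]
      exact Nat.find_spec h
    have he_le : ∀ t, e (val t) ≤ termCode t := fun t => by
      have h : ∃ g, P (val t) g := ⟨_, t, rfl, rfl⟩
      simp only [e, dif_pos h]
      exact Nat.find_min' h ⟨t, rfl, rfl⟩
    have he_inj : ∀ t t', e (val t) = e (val t') → val t = val t' := fun t t' h => by
      obtain ⟨u, hu, hu'⟩ := he_spec t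
      obtain ⟨w, hw, hw'⟩ := he_spec t'
      rw [← hu', ← hw', termCode_injective (hu.trans (h.trans hw.symm))]
    -- The names for which `s` leads to a name that still fits in the table; other entries are set
    -- to 0. Which `t` is chosen does not matter, by `he_inj`.
    let S (g : ℕ) : Prop := ∃ t, e (val t) = g ∧ e (sMap (val t)) < G
    obtain ⟨c, hc, hc'⟩ := exists_digits_eq (N := G) (B := G)
      (fun g => if h : S g then e (sMap (val h.choose)) else 0) fun g _ => by
        split_ifs with h
        · exact h.choose_spec.2
        · exact hG0
    -- Variable `i` is encoded in `ℕ ⊕ Fin 0` as `2 * i`, so its value is stored at position `2 *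
    -- i`; hence the index `j / 2`.
    obtain ⟨d, hd, hd'⟩ := exists_digits_eq (N := G) (B := G)
      (fun j => if e (v (j / 2)) < G then e (v (j / 2)) else 0) fun j _ => by
        split_ifs with h
        · exact h
        · exact hG0
    refine ⟨c, hc, d, hd, ?_⟩
    refine (evalCode_iff (G := formulaCode φ) (fun ψ hψ hle => ?_) hφ le_rfl).2 hv
    refine evalAtomS_iff (G := G) e (fun t t' _ _ => he_inj t t')
      (termValue_eq _ (fun i hi => ?_) (fun t ht => ?_)) hψ (by omega)
    · have h := he_le (Term.var (Sum.inl i))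
      rw [termCode, Encodable.encode_inl, Encodable.encode_nat] at h
      have h : e (v i) < G := lt_of_le_of_lt h (by omega)
      rw [hd' _ (by omega), Nat.mul_div_cancel_left _ (by norm_num), if_pos h]
    · have h : e (sMap (val t)) < G := by
        rw [← realize_sTerm]
        exact (he_le (sTerm t)).trans_lt ht
      have hlt := argCode_lt (termCode_sTerm_mod_two t)
      rw [argCode_termCode_sTerm] at hlt
      have hS : S (e (val t)) := ⟨t, rfl, h⟩
      rw [hc' _ (((he_le t).trans_lt hlt).trans ht), dif_pos hS,
        he_inj _ _ hS.choose_spec.1]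

end UnaryFunction

/-! ### Decidability of $T_=$ -/

section NullaryPredicates

/-- The truth value of the atomic formula with Gödel number `g` in the structure with domain
`{0, …, N - 1}`, where the assignment is given by the digits of `d`, and where `P N` is true if
`b = 1` and all other predicates are false. -/
def evalAtomP (p : ℕ × ℕ × ℕ) (g : ℕ) : Bool :=
  if g.unpair.1 = 1 then
    digit p.1 p.2.2 (g.unpair.2.unpair.1 / 4) == digit p.1 p.2.2 (g.unpair.2.unpair.2 / 4)
  else p.2.1 == 1 && g.unpair.2.unpair.1 + 1 == p.1

theorem primrec₂_evalAtomP : Primrec₂ evalAtomP := by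
  have hun : Primrec fun q : (ℕ × ℕ × ℕ) × ℕ => q.2.unpair := Primrec.unpair.comp Primrec.snd
  have hun2 : Primrec fun q : (ℕ × ℕ × ℕ) × ℕ => q.2.unpair.2.unpair :=
    Primrec.unpair.comp (Primrec.snd.comp hun)
  have hN : Primrec fun q : (ℕ × ℕ × ℕ) × ℕ => q.1.1 := Primrec.fst.comp Primrec.fst
  have hb : Primrec fun q : (ℕ × ℕ × ℕ) × ℕ => q.1.2.1 :=
    Primrec.fst.comp (Primrec.snd.comp Primrec.fst)
  have hd : Primrec fun q : (ℕ × ℕ × ℕ) × ℕ => q.1.2.2 :=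
    Primrec.snd.comp (Primrec.snd.comp Primrec.fst)
  have h : Primrec fun q : (ℕ × ℕ × ℕ) × ℕ => evalAtomP q.1 q.2 :=
    Primrec.ite (Primrec.eq.comp (Primrec.fst.comp hun) (Primrec.const 1))
      (Primrec.beq.comp
        (primrec_digit hN hd (Primrec.nat_div.comp (Primrec.fst.comp hun2) (Primrec.const 4)))
        (primrec_digit hN hd (Primrec.nat_div.comp (Primrec.snd.comp hun2) (Primrec.const 4))))
      (Primrec.and.comp (Primrec.beq.comp hb (Primrec.const 1))
        (Primrec.beq.comp (Primrec.succ.comp (Primrec.fst.comp hun2)) hN))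
  exact h

/-- Some structure of size at most `g + 1`, in which at most the predicate belonging to this size is
true, satisfies the formula with Gödel number `g`. -/
def SearchP (g : ℕ) : Prop :=
  ∃ N < g + 2, ∃ b < 2, ∃ d < (g + 1) ^ (g + 1),
    0 < N ∧ evalCode (evalAtomP (N, b, d)) g = true

theorem primrecPred_searchP : PrimrecPred SearchP := by
  have h0 : Primrec₂ fun (p : ℕ × ℕ × ℕ) (g : ℕ) => evalCode (evalAtomP p) g :=
    primrec₂_evalCode primrec₂_evalAtomP
  have hpow : Primrec fun g : ℕ => (g + 1) ^ (g + 1) :=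
    (Primrec₂.unpaired'.1 Nat.Primrec.pow).comp Primrec.succ Primrec.succ
  have h1 : PrimrecRel fun (d : ℕ) (q : ℕ × ℕ × ℕ) =>
      0 < q.2.1 ∧ evalCode (evalAtomP (q.2.1, q.1, d)) q.2.2 = true := by
    have h : Primrec fun x : ℕ × ℕ × ℕ × ℕ =>
        evalCode (evalAtomP (x.2.2.1, x.2.1, x.1)) x.2.2.2 :=
      h0.comp ((Primrec.fst.comp (Primrec.snd.comp Primrec.snd)).pair
        ((Primrec.fst.comp Primrec.snd).pair Primrec.fst))
        (Primrec.snd.comp (Primrec.snd.comp Primrec.snd))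
    exact (Primrec.nat_lt.comp (Primrec.const 0)
      (Primrec.fst.comp (Primrec.snd.comp Primrec.snd))).and
      (Primrec.eq.comp h (Primrec.const true))
  have h2 : PrimrecRel fun (b : ℕ) (q : ℕ × ℕ) => ∃ d < (q.2 + 1) ^ (q.2 + 1),
      0 < q.1 ∧ evalCode (evalAtomP (q.1, b, d)) q.2 = true := by
    have h1' := primrecRel_exists_lt h1
    have h : PrimrecPred fun q : ℕ × ℕ × ℕ => ∃ d < (q.2.2 + 1) ^ (q.2.2 + 1),
        0 < q.2.1 ∧ evalCode (evalAtomP (q.2.1, q.1, d)) q.2.2 = true :=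
      h1'.comp (hpow.comp (Primrec.snd.comp Primrec.snd)) Primrec.id
    exact h
  have h3 : PrimrecRel fun N g : ℕ => ∃ b < 2, ∃ d < (g + 1) ^ (g + 1),
      0 < N ∧ evalCode (evalAtomP (N, b, d)) g = true := by
    have h2' := primrecRel_exists_lt h2
    have h : PrimrecPred fun q : ℕ × ℕ => ∃ b < 2, ∃ d < (q.2 + 1) ^ (q.2 + 1),
        0 < q.1 ∧ evalCode (evalAtomP (q.1, b, d)) q.2 = true :=
      h2'.comp (Primrec.const 2) Primrec.id
    exact h
  exact (primrecRel_exists_lt h3).comp (Primrec.nat_add.comp Primrec.id (Primrec.const 2))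
    Primrec.id

theorem term_eq_var (t : sigP.Term (ℕ ⊕ Fin 0)) : ∃ i, t = Term.var (Sum.inl i) := by
  cases t with
  | var x =>
    rcases x with i | i
    · exact ⟨i, rfl⟩
    · exact i.elim0
  | func g ts => exact Empty.elim g

theorem termCode_var {L : FirstOrder.Language.{0, 0}} [EffectiveSignature L] (i : ℕ) :
    termCode (Term.var (Sum.inl i) : L.Term (ℕ ⊕ Fin 0)) = 2 * (2 * i) := by
  rw [termCode, Encodable.encode_inl, Encodable.encode_nat]

theorem evalAtomP_iff {M : Type} [sigP.Structure M] {v : ℕ → M} {N b d G : ℕ}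
    (hvar : ∀ i j, i < G → j < G → (digit N d i = digit N d j ↔ v i = v j))
    (hrel : ∀ n : ℕ+, n ≤ G → (b = 1 ∧ n = N ↔
      Structure.RelMap (L := sigP) (M := M) (PRel.P n) Fin.elim0))
    {φ : sigP.Formula ℕ} (hφ : φ.IsAtomic) (hG : formulaCode φ < G) :
    evalAtomP (N, b, d) (formulaCode φ) = true ↔ φ.Realize v := by
  cases hφ with
  | equal t₁ t₂ =>
    obtain ⟨i, rfl⟩ := term_eq_var t₁
    obtain ⟨j, rfl⟩ := term_eq_var t₂
    have h : formulaCode ((Term.var (Sum.inl i)).bdEqual (Term.var (Sum.inl j)) : sigP.Formula ℕ) =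
        Nat.pair 1 (Nat.pair (2 * (2 * i)) (2 * (2 * j))) := by
      rw [Term.bdEqual, formulaCode, termCode_var, termCode_var]
    rw [h] at hG ⊢
    have hlt := (lt_pair_left_of_pos one_pos _).trans hG
    have h₁ := (Nat.left_le_pair _ _).trans_lt hlt
    have h₂ := (Nat.right_le_pair _ _).trans_lt hlt
    have h4 : ∀ k, 2 * (2 * k) / 4 = k := fun k => by omega
    simp only [evalAtomP, Nat.unpair_pair, if_true, beq_iff_eq, h4, hvar i j (by omega) (by omega),
      Formula.Realize, BoundedFormula.realize_bdEqual, Term.realize_var, Sum.elim_inl]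
  | rel R ts =>
    cases R with | P n =>
    have h : formulaCode (Relations.boundedFormula (L := sigP) (PRel.P n) ts : sigP.Formula ℕ) =
        Nat.pair 2 (Nat.pair n.natPred 0) := rfl
    rw [h] at hG ⊢
    have hlt := (Nat.left_le_pair _ _).trans_lt ((lt_pair_left_of_pos two_pos _).trans hG)
    have hn := n.natPred_add_one
    simp only [evalAtomP, Nat.unpair_pair, OfNat.ofNat_ne_one, if_false, Bool.and_eq_true,
      beq_iff_eq, hn]
    rw [hrel n (by omega)]
    refine Iff.trans ?_ BoundedFormula.realize_rel.symm
    exact iff_of_eq (congrArg _ (funext fun i => i.elim0))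

/-- The structure on `M` in which `P n` is true if and only if `p n`. -/
@[reducible] def predStructure (M : Type) (p : ℕ+ → Prop) : sigP.Structure M where
  funMap := fun {_} g => Empty.elim g
  RelMap := fun {_} r _ => match r with | PRel.P n => p n

/-- If some `P n` with `n ≤ G` holds in a model, then the model has `n` elements, no other predicate
holds, and it can be copied to `Fin n`. Otherwise all predicates that `φ` can mention are false, and
the values of the first `G` variables are all that matters. -/
theorem searchP_iff {φ : sigP.Formula ℕ} (hφ : φ.IsQF) :
    SearchP (formulaCode φ) ↔ Satisfiable theoryEq φ := by
  set G := formulaCode φ + 1 with hG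
  constructor
  · rintro ⟨N, -, b, -, d, -, hN, h⟩
    let inst := predStructure (Fin N) fun n => b = 1 ∧ n = N
    have : Nonempty (Fin N) := ⟨⟨0, hN⟩⟩
    refine ⟨Fin N, inst, fun i => ⟨digit N d i, digit_lt hN _ _⟩, ?_, ?_⟩
    · refine model_theoryEq_iff.2 fun n hn => ?_
      have hn : b = 1 ∧ (n : ℕ) = N := hn
      rw [hn.2, ENat.card_eq_coe_fintype_card, Fintype.card_fin]
    · refine (evalCode_iff (G := formulaCode φ) (fun ψ hψ hle => ?_) hφ le_rfl).1 h
      exact evalAtomP_iff (G := G) (fun i j _ _ => by rw [Fin.mk.injEq]) (fun n _ => Iff.rfl) hψ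
        (by omega)
  · rintro ⟨M, _, v, hM, hv⟩
    have : Nonempty M := ⟨v 0⟩
    rw [model_theoryEq_iff] at hM
    -- Both cases supply a size `N`, a flag `b` for `P N`, and a numbering `e` of the variables with
    -- the same equalities as `v`.
    suffices H : ∃ N, 0 < N ∧ N < G + 1 ∧ ∃ b < 2, (∀ n : ℕ+, n ≤ G → (b = 1 ∧ n = N ↔
        Structure.RelMap (L := sigP) (M := M) (PRel.P n) Fin.elim0)) ∧
        ∃ e : ℕ → ℕ, ∀ i < G, e i < N ∧ ∀ j < G, (e i = e j ↔ v i = v j) by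
      obtain ⟨N, hN, hNG, b, hb, hrel, e, he⟩ := H
      obtain ⟨d, hd, hd'⟩ := exists_digits_eq e fun j hj => (he j hj).1
      refine ⟨N, by omega, b, hb, d, hd.trans_le (Nat.pow_le_pow_left (by omega) _), hN, ?_⟩
      refine (evalCode_iff (G := formulaCode φ) (fun ψ hψ hle => ?_) hφ le_rfl).2 hv
      exact evalAtomP_iff (G := G) (fun i j hi hj => by rw [hd' i hi, hd' j hj, (he i hi).2 j hj])
        hrel hψ (by omega)
    classical
    by_cases h : ∃ n : ℕ+, n ≤ G ∧ Structure.RelMap (L := sigP) (M := M) (PRel.P n) Fin.elim0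
    · obtain ⟨n, hn, hP⟩ := h
      have hc := hM n hP
      have hfin : Finite M := by
        rw [← ENat.card_lt_top, hc]
        exact ENat.natCast_lt_top _
      have hc' : Nat.card M = n := by
        rw [ENat.card_eq_coe_natCard] at hc
        exact_mod_cast hc
      let e := Finite.equivFinOfCardEq hc'
      refine ⟨n, n.pos, by omega, 1, by norm_num, fun m hm => ?_, fun i => e (v i),
        fun i _ => ⟨(e (v i)).2, fun j _ => ?_⟩⟩
      · constructor
        · rintro ⟨-, h⟩
          rwa [PNat.coe_injective h]
        · intro h
          have := (hM m h).symm.trans hc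
          exact ⟨rfl, by exact_mod_cast this⟩
      · rw [← Fin.ext_iff, e.injective.eq_iff]
    -- A predicate with index above `G` may hold in `M`; it is dropped, since `φ` cannot contain it.
    -- Each variable is numbered by the least variable with the same value.
    · have hex : ∀ i, ∃ j, v j = v i := fun i => ⟨i, rfl⟩
      refine ⟨G, Nat.succ_pos _, by omega, 0, by norm_num, fun n hn => ?_,
        fun i => Nat.find (hex i), fun i hi => ⟨(Nat.find_min' (hex i) rfl).trans_lt hi,
          fun j _ => ⟨fun h => ?_, fun h => ?_⟩⟩⟩
      · exact ⟨fun h => absurd h.1 (by norm_num), fun hP => absurd ⟨n, hn, hP⟩ h⟩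
      · rw [← Nat.find_spec (hex i), show Nat.find (hex i) = Nat.find (hex j) from h,
          Nat.find_spec (hex j)]
      · simp only [h]

theorem isDecidable_theoryEq : IsDecidable theoryEq := by
  classical
  exact ⟨fun g => decide (SearchP g), primrecPred_searchP.computablePred.decide,
    fun φ hφ => by rw [decide_eq_true_eq, searchP_iff hφ]⟩

end NullaryPredicates

/-! ### $T_f$ is stably infinite and decidable -/

section StablyInfinite

variable {M : Type}

/-- The extension of a structure by infinitely many fixed points and infinitely many non-fixed
points of `s`. -/
@[reducible] def extendStructure (M : Type) [sigS.Structure M] :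
    sigS.Structure (M ⊕ ℕ × Bool) where
  funMap := fun {_} g x => match g with
    | SFun.s => (x 0).elim (fun y => Sum.inl (sMap y)) fun q => Sum.inr (q.1, true)
  RelMap := fun {_} r => Empty.elim r

/-- Quantifier-free formulas are preserved by embeddings, and in the extension both fixed and
non-fixed points are infinite in number, so the first disjunct of each axiom holds. The structure
`M` need not be a model of $T_f$. -/
theorem exists_infinite_model_theoryF (f : ℕ+ → Fin 2) {φ : sigS.Formula ℕ} (hφ : φ.IsQF)
    [sigS.Structure M] {v : ℕ → M} (hv : φ.Realize v) :
    ∃ (M' : Type) (_ : sigS.Structure M') (v' : ℕ → M'),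
      Infinite M' ∧ M' ⊨ theoryF f ∧ φ.Realize v' := by
  let _ := extendStructure M
  let e : M ↪[sigS] (M ⊕ ℕ × Bool) :=
    { toFun := Sum.inl
      inj' := Sum.inl_injective
      map_fun' := by
        rintro _ ⟨⟩ x
        have : x = ![x 0] := by ext i; fin_cases i; rfl
        rw [this]
        rfl
      map_rel' := fun r => Empty.elim r }
  have hfix : ∀ b, (fixSet (M ⊕ ℕ × Bool) b).encard = ⊤ := fun b => by
    rw [Set.encard_eq_top_iff]
    refine (Set.infinite_range_of_injective (f := fun n : ℕ => (Sum.inr (n, b) : M ⊕ ℕ × Bool))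
      fun m n h => by simpa using h).mono ?_
    rintro _ ⟨n, rfl⟩
    change (Sum.inr (n, true) : M ⊕ ℕ × Bool) = Sum.inr (n, b) ↔ b = true
    cases b <;> simp
  refine ⟨M ⊕ ℕ × Bool, inferInstance, e ∘ v, inferInstance, ?_, ?_⟩
  · rw [model_theoryF_iff]
    exact fun k => Or.inl ⟨by simp [hfix], by simp [hfix]⟩
  · have := (hφ.realize_embedding e (v := v) (xs := default)).2 hv
    rw [Formula.Realize]
    convert this

theorem stablyInfinite_theoryF (f : ℕ+ → Fin 2) : StablyInfinite (theoryF f) := by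
  rintro φ hφ ⟨M, _, v, -, hv⟩
  exact exists_infinite_model_theoryF f hφ hv

/-- One algorithm, the search for plain satisfiability, serves every `f`, computable or not. -/
theorem isDecidable_theoryF (f : ℕ+ → Fin 2) : IsDecidable (theoryF f) := by
  classical
  refine ⟨fun g => decide (SearchS g), primrecPred_searchS.computablePred.decide, fun φ hφ => ?_⟩
  rw [decide_eq_true_eq, searchS_iff hφ]
  constructor
  · rintro ⟨M, _, v, hv⟩
    obtain ⟨M', i, v', -, h, h'⟩ := exists_infinite_model_theoryF f hφ hv
    exact ⟨M', i, v', h, h'⟩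
  · rintro ⟨M, i, v, -, hv⟩
    exact ⟨M, i, v, hv⟩

end StablyInfinite

/-! ### Satisfiability in the combined theory -/

section Combination

variable (f : ℕ+ → Fin 2)

/-- In a model of `T_f` of finite size `k`, exactly `f₁(k)` elements are fixed by `s`. -/
theorem encard_fixSet_of_card_eq {M : Type} [sigS.Structure M] {k : ℕ+} (hM : M ⊨ theoryF f)
    (hk : ENat.card M = (k : ℕ)) : (fixSet M true).encard = countVal f 1 k := by
  have hsum : (fixSet M true).encard + (fixSet M false).encard = (k : ℕ) := by
    rw [fixSet_false, Set.encard_add_encard_compl, Set.encard_univ, hk]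
  -- The axiom for `k + 1` is used because its first disjunct would require `k + 1` elements. The
  -- second determines the size as `j`, so `j = k`.
  rcases (model_theoryF_iff f).1 hM (k + 1) with ⟨h1, h0⟩ | ⟨j, -, h1, h0⟩
  · have h := add_le_add h1 h0
    rw [hsum, ← Nat.cast_add, countVal_one_add_countVal_zero, Nat.cast_le, PNat.add_coe,
      PNat.one_coe] at h
    omega
  · rw [h1, h0, ← Nat.cast_add, countVal_one_add_countVal_zero, Nat.cast_inj] at hsum
    rw [h1, PNat.coe_injective hsum]

/-- The structure with domain `{0, …, k - 1}` in which `s` fixes the numbers below `a` and maps all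
others to `0`. -/
@[reducible] def thresholdStructure (a k : ℕ) (hk : 0 < k) : sigS.Structure (Fin k) where
  funMap := fun {_} g x => match g with | SFun.s => if x 0 < a then x 0 else ⟨0, hk⟩
  RelMap := fun {_} r => Empty.elim r

/-- Positivity of `a` puts 0 below the threshold, so the elements sent to 0 are really moved. -/
theorem fixSet_thresholdStructure {a k : ℕ} (hk : 0 < k) (ha : 0 < a) (b : Bool) :
    @fixSet (Fin k) (thresholdStructure a k hk) b = {x : Fin k | (x : ℕ) < a ↔ b = true} := by
  let _ := thresholdStructure a k hk
  ext x
  rw [fixSet, Set.mem_ofPred_eq, Set.mem_ofPred_eq]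
  have h : sMap x = x ↔ (x : ℕ) < a := by
    change (if x < a then x else ⟨0, hk⟩) = x ↔ _
    split_ifs with h
    · simp [h]
    · simp only [Fin.ext_iff, h, iff_false]
      omega
  rw [h]

theorem encard_fixSet_thresholdStructure {a k : ℕ} (hk : 0 < k) (ha : 0 < a) (hak : a ≤ k) :
    (@fixSet (Fin k) (thresholdStructure a k hk) true).encard = a := by
  rw [fixSet_thresholdStructure hk ha, ← exists_enumeration_iff_encard_eq]
  refine ⟨Fin.castLE hak, ⟨Fin.castLE_injective hak, fun i => by simp⟩, fun y hy => ?_⟩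
  exact ⟨⟨y, by simpa using hy⟩, rfl⟩

/-- Axioms with index at most `k` hold by monotonicity of the counts, the others through the
disjunct for `k` itself. The value `f 1 = 1` guarantees a fixed point, as the threshold construction
requires. -/
theorem model_thresholdStructure (h1 : f 1 = 1) (k : ℕ+) :
    @Theory.Model sigS (Fin k) (thresholdStructure (countVal f 1 k) k k.pos) (theoryF f) := by
  let _ := thresholdStructure (countVal f 1 k) k k.pos
  have hpos : 0 < countVal f 1 k := by
    refine lt_of_lt_of_le ?_ (countVal_mono f 1 (one_le (a := k)))
    rw [countVal_one, if_pos h1]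
    exact one_pos
  have hadd := countVal_one_add_countVal_zero f k
  have ht : (fixSet (Fin k) true).encard = countVal f 1 k :=
    encard_fixSet_thresholdStructure k.pos hpos (by omega)
  have hf : (fixSet (Fin k) false).encard = countVal f 0 k := by
    have h := Set.encard_add_encard_compl (fixSet (Fin k) true)
    rw [ht, ← fixSet_false, Set.encard_univ, ENat.card_eq_coe_fintype_card, Fintype.card_fin] at h
    replace h := h.trans (by rw [← hadd, Nat.cast_add] : ((k : ℕ) : ℕ∞) =
      countVal f 1 k + countVal f 0 k)
    exact ENat.add_right_injective_of_ne_top (ENat.natCast_ne_top _) h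
  rw [model_theoryF_iff]
  intro l
  rcases le_total l k with h | h
  · refine Or.inl ⟨?_, ?_⟩
    · rw [ht]; exact_mod_cast countVal_mono f 1 h
    · rw [hf]; exact_mod_cast countVal_mono f 0 h
  · exact Or.inr ⟨k, h, ht, hf⟩

theorem isQF_conj {L : FirstOrder.Language.{0, 0}} {α : Type} {n : ℕ}
    {l : List (L.BoundedFormula α n)} (h : ∀ φ ∈ l, φ.IsQF) : (conj l).IsQF := by
  induction l with
  | nil => exact BoundedFormula.IsQF.falsum.imp .falsum
  | cons φ l ih =>
    exact (h φ (by simp)).inf (ih fun ψ hψ => h ψ (by simp [hψ]))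

theorem isQF_phiFixGe (m : ℕ) : (phiFixGe m).IsQF := by
  refine BoundedFormula.IsQF.inf (isQF_conj fun φ hφ => ?_) (isQF_conj fun φ hφ => ?_)
  · obtain ⟨ij, -, rfl⟩ := List.mem_map.1 hφ
    exact (BoundedFormula.IsAtomic.equal _ _).isQF.not
  · obtain ⟨i, -, rfl⟩ := List.mem_map.1 hφ
    exact (BoundedFormula.IsAtomic.equal _ _).isQF

theorem isQF_onBoundedFormula {L L' : FirstOrder.Language.{0, 0}} (g : L →ᴸ L') {α : Type} {n : ℕ}
    {φ : L.BoundedFormula α n} (h : φ.IsQF) : (g.onBoundedFormula φ).IsQF := by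
  induction h with
  | falsum => exact BoundedFormula.isQF_bot
  | of_isAtomic h =>
    cases h with
    | equal t₁ t₂ => exact (BoundedFormula.IsAtomic.equal _ _).isQF
    | rel R ts => exact (BoundedFormula.IsAtomic.rel _ _).isQF
  | imp _ _ ih₁ ih₂ => exact ih₁.imp ih₂

theorem isQF_testFormula (n : ℕ+) : (testFormula f n).IsQF :=
  (isQF_onBoundedFormula _ (BoundedFormula.IsAtomic.rel _ _).isQF).inf
    (isQF_onBoundedFormula _ (isQF_phiFixGe _))

/-- A structure for the sum of two languages is a pair of structures on one domain. -/
theorem satisfiable_combine_iff {L₁ L₂ : FirstOrder.Language.{0, 0}} {T₁ : L₁.Theory}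
    {T₂ : L₂.Theory} {φ₁ : L₁.Formula ℕ} {φ₂ : L₂.Formula ℕ} :
    Satisfiable (combine T₁ T₂) (LHom.sumInr.onFormula φ₂ ⊓ LHom.sumInl.onFormula φ₁) ↔
      ∃ (M : Type) (_ : L₁.Structure M) (_ : L₂.Structure M) (v : ℕ → M),
        (M ⊨ T₁ ∧ φ₁.Realize v) ∧ M ⊨ T₂ ∧ φ₂.Realize v := by
  constructor
  · rintro ⟨M, _, v, hM, hv⟩
    let _ : L₁.Structure M := (LHom.sumInl : L₁ →ᴸ L₁.sum L₂).reduct M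
    let _ : L₂.Structure M := (LHom.sumInr : L₂ →ᴸ L₁.sum L₂).reduct M
    rw [combine, Theory.model_union_iff, LHom.onTheory_model, LHom.onTheory_model] at hM
    rw [Formula.realize_inf, LHom.realize_onFormula, LHom.realize_onFormula] at hv
    exact ⟨M, inferInstance, inferInstance, v, ⟨hM.1, hv.2⟩, hM.2, hv.1⟩
  · rintro ⟨M, _, _, v, ⟨h1, h1'⟩, h2, h2'⟩
    refine ⟨M, inferInstance, v, ?_, ?_⟩
    · rw [combine, Theory.model_union_iff, LHom.onTheory_model, LHom.onTheory_model]
      exact ⟨h1, h2⟩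
    · rw [Formula.realize_inf, LHom.realize_onFormula, LHom.realize_onFormula]
      exact ⟨h2', h1'⟩

theorem satisfiable_testFormula_iff (h1 : f 1 = 1) (n : ℕ+) :
    Satisfiable (combine (theoryF f) theoryEq) (testFormula f n) ↔ f (n + 1) = 1 := by
  rw [testFormula, satisfiable_combine_iff]
  constructor
  · rintro ⟨M, _, _, v, ⟨hF, hfix⟩, hE, hP⟩
    have : Nonempty M := ⟨v 0⟩
    have hc := model_theoryEq_iff.1 hE (n + 1) ((realize_atomP _ _).1 hP)
    have hle := exists_injective_iff_le_encard.1
      ⟨fun i : Fin (countVal f 1 n + 1) => v i, (realize_phiFixGe _ _).1 hfix⟩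
    rw [Set.ofPred_mem_eq, encard_fixSet_of_card_eq f hF hc, Nat.cast_le, countVal_add_one] at hle
    by_contra h
    rw [if_neg h] at hle
    omega
  · intro h
    let _ := thresholdStructure (countVal f 1 (n + 1)) (n + 1 : ℕ+) (n + 1).pos
    let _ := predStructure (Fin (n + 1 : ℕ+)) fun m => m = n + 1
    have hcount : countVal f 1 (n + 1) = countVal f 1 n + 1 := by
      rw [countVal_add_one, if_pos h]
    have hadd := countVal_one_add_countVal_zero f (n + 1)
    have : Nonempty (Fin (n + 1 : ℕ+)) := ⟨⟨0, (n + 1).pos⟩⟩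
    let v : ℕ → Fin (n + 1 : ℕ+) := fun i =>
      if hi : i < (n + 1 : ℕ+) then ⟨i, hi⟩ else ⟨0, (n + 1).pos⟩
    have hv : ∀ i < countVal f 1 n + 1, (v i : ℕ) = i := fun i hi => by
      simp only [v]
      rw [dif_pos (by omega)]
    refine ⟨Fin (n + 1 : ℕ+), inferInstance, inferInstance, v,
      ⟨model_thresholdStructure f h1 (n + 1), ?_⟩, model_theoryEq_iff.2 ?_, ?_⟩
    · rw [realize_phiFixGe]
      refine ⟨fun i j hij => ?_, fun i => ?_⟩
      · have := congrArg Fin.val hij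
        simp only [hv _ i.2, hv _ j.2] at this
        exact Fin.ext this
      · rw [fixSet_thresholdStructure _ (by omega)]
        simp only [Set.mem_ofPred_eq, hv _ i.2, iff_true, hcount]
        exact i.2
    · intro m hm
      have hm : m = n + 1 := hm
      rw [hm, ENat.card_eq_coe_fintype_card, Fintype.card_fin]
    · rw [realize_atomP]
      exact rfl

end Combination

/-! ### Gödel numbers of the test formulas and undecidability -/

section Codes

/-- The Gödel number of `¬ φ`, where `a` is that of `φ`. -/
def notCode (a : ℕ) : ℕ := Nat.pair 3 (Nat.pair a (Nat.pair 0 0))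

/-- The Gödel number of `φ ∧ ψ`, where `a` and `b` are those of `φ` and `ψ`. -/
def infCode (a b : ℕ) : ℕ := notCode (Nat.pair 3 (Nat.pair a (notCode b)))

theorem primrec_notCode : Primrec notCode :=
  Primrec₂.natPair.comp (Primrec.const 3) (Primrec₂.natPair.comp Primrec.id (Primrec.const _))

theorem primrec₂_infCode : Primrec₂ infCode :=
  primrec_notCode.comp (Primrec₂.natPair.comp (Primrec.const 3)
    (Primrec₂.natPair.comp Primrec.fst (primrec_notCode.comp Primrec.snd)))

section

variable {L L' : FirstOrder.Language.{0, 0}} [EffectiveSignature L] {n : ℕ}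

theorem formulaCode_not (φ : L.BoundedFormula ℕ n) :
    formulaCode φ.not = notCode (formulaCode φ) := by
  rw [BoundedFormula.not, formulaCode]
  change _ = Nat.pair 3 (Nat.pair _ (Nat.pair 0 0))
  congr 2

theorem formulaCode_inf (φ ψ : L.BoundedFormula ℕ n) :
    formulaCode (φ ⊓ ψ) = infCode (formulaCode φ) (formulaCode ψ) := by
  change formulaCode (φ.imp ψ.not).not = _
  rw [formulaCode_not, formulaCode, formulaCode_not, infCode]

/-- The Gödel number of the conjunction of a list of formulas with the given Gödel numbers. -/
def conjCode (l : List ℕ) : ℕ := l.foldr infCode (notCode (Nat.pair 0 0))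

theorem primrec_conjCode : Primrec conjCode :=
  Primrec.list_foldr (f := fun l : List ℕ => l) (h := fun _ q => infCode q.1 q.2) Primrec.id
    (Primrec.const (notCode (Nat.pair 0 0)))
    (primrec₂_infCode.comp (Primrec.fst.comp Primrec.snd) (Primrec.snd.comp Primrec.snd))

theorem formulaCode_onBoundedFormula_conj (g : L' →ᴸ L) (l : List (L'.BoundedFormula ℕ n)) :
    formulaCode (g.onBoundedFormula (conj l)) =
      conjCode (l.map fun φ => formulaCode (g.onBoundedFormula φ)) := by
  induction l with
  | nil =>
    change formulaCode (BoundedFormula.not ⊥ : L.BoundedFormula ℕ n) = _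
    rw [formulaCode_not]
    rfl
  | cons φ l ih =>
    change formulaCode (g.onBoundedFormula φ ⊓ g.onBoundedFormula (conj l)) = _
    rw [formulaCode_inf, ih]
    rfl

end

/-- The pairs `(i, j)` with `i < j < m`. -/
def ltPairs (m : ℕ) : List (ℕ × ℕ) :=
  ((List.range m).flatMap fun i => (List.range m).map fun j => (i, j)).filter fun q => q.1 < q.2

theorem primrec_ltPairs : Primrec ltPairs := by
  have h : Primrec fun m : ℕ =>
      (List.range m).flatMap fun i => (List.range m).map fun j => (i, j) :=
    Primrec.list_flatMap Primrec.list_range (Primrec.list_map (Primrec.list_range.comp Primrec.fst)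
      ((Primrec.snd.comp Primrec.fst).pair Primrec.snd))
  exact (Primrec.listFilter Primrec.nat_lt).comp h

theorem ltPairs_eq (m : ℕ) : ltPairs m =
    ((List.finRange m ×ˢ List.finRange m).filter fun ij => ij.1 < ij.2).map
      fun ij => ((ij.1 : ℕ), (ij.2 : ℕ)) := by
  have h : (List.range m).flatMap (fun i => (List.range m).map fun j => (i, j)) =
      (List.finRange m ×ˢ List.finRange m).map fun ij => ((ij.1 : ℕ), (ij.2 : ℕ)) := by
    rw [← List.map_coe_finRange_eq_range]
    simp only [SProd.sprod, List.product, List.flatMap_map, List.map_flatMap, List.map_map]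
    rfl
  rw [ltPairs, h, List.filter_map]
  rfl

/-- The Gödel number of `¬ (xᵢ = xⱼ)`. -/
def neCode (q : ℕ × ℕ) : ℕ :=
  notCode (Nat.pair 1 (Nat.pair (2 * (2 * q.1)) (2 * (2 * q.2))))

/-- The Gödel number of `s(xᵢ) = xᵢ`. -/
def fixCode (i : ℕ) : ℕ :=
  Nat.pair 1 (Nat.pair (2 * Nat.pair 0 (Nat.pair (2 * (2 * i)) 0 + 1) + 1) (2 * (2 * i)))

/-- The Gödel number of `P_{n+2} ∧ φ^=_{≥ m}`. -/
def testCode (n m : ℕ) : ℕ :=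
  -- $P_{n+2}$ has code $n+1$ in its own signature, and symbols of the second summand get odd codes.
  -- The code 0 of `s` is unchanged in the sum.
  infCode (Nat.pair 2 (Nat.pair (2 * (n + 1) + 1) 0))
    (infCode (conjCode ((ltPairs m).map neCode)) (conjCode ((List.range m).map fixCode)))

theorem primrec₂_testCode : Primrec₂ testCode := by
  have hmul : Primrec fun n : ℕ => 2 * n := Primrec.nat_mul.comp (Primrec.const 2) Primrec.id
  have hvar : Primrec fun n : ℕ => 2 * (2 * n) := hmul.comp hmul
  have hne : Primrec neCode := primrec_notCode.comp (Primrec₂.natPair.comp (Primrec.const 1)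
    (Primrec₂.natPair.comp (hvar.comp Primrec.fst) (hvar.comp Primrec.snd)))
  have hfix : Primrec fixCode := Primrec₂.natPair.comp (Primrec.const 1)
    (Primrec₂.natPair.comp (Primrec.succ.comp (hmul.comp (Primrec₂.natPair.comp (Primrec.const 0)
      (Primrec.succ.comp (Primrec₂.natPair.comp hvar (Primrec.const 0)))))) hvar)
  have hP : Primrec fun n : ℕ => Nat.pair 2 (Nat.pair (2 * (n + 1) + 1) 0) :=
    Primrec₂.natPair.comp (Primrec.const 2)
      (Primrec₂.natPair.comp (Primrec.succ.comp (hmul.comp Primrec.succ)) (Primrec.const 0))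
  have h1 : Primrec fun m : ℕ => conjCode ((ltPairs m).map neCode) :=
    primrec_conjCode.comp (Primrec.list_map primrec_ltPairs (hne.comp Primrec.snd))
  have h2 : Primrec fun m : ℕ => conjCode ((List.range m).map fixCode) :=
    primrec_conjCode.comp (Primrec.list_map Primrec.list_range (hfix.comp Primrec.snd))
  exact primrec₂_infCode.comp (hP.comp Primrec.fst)
    (primrec₂_infCode.comp (h1.comp Primrec.snd) (h2.comp Primrec.snd))

theorem formulaCode_onBoundedFormula_phiFixGe (m : ℕ) :
    formulaCode ((LHom.sumInl : sigS →ᴸ sigS.sum sigP).onBoundedFormula (phiFixGe m)) =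
      infCode (conjCode ((ltPairs m).map neCode)) (conjCode ((List.range m).map fixCode)) := by
  have h : (LHom.sumInl : sigS →ᴸ sigS.sum sigP).onBoundedFormula (phiFixGe m) =
      LHom.sumInl.onBoundedFormula (distinct fun i : Fin m => Term.var (Sum.inl (i : ℕ))) ⊓
      LHom.sumInl.onBoundedFormula (conj ((List.range m).map fun i =>
        fixLit true (Term.var (Sum.inl i)))) := by
    rw [← coe_finRange_eq_range]
    rfl
  rw [h, formulaCode_inf, distinct, formulaCode_onBoundedFormula_conj,
    formulaCode_onBoundedFormula_conj, ltPairs_eq, List.map_map, List.map_map, List.map_map]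
  congr 3

theorem formulaCode_testFormula (f : ℕ+ → Fin 2) (n : ℕ) :
    formulaCode (testFormula f n.succPNat) = testCode n (countVal f 1 n.succPNat + 1) := by
  have h : formulaCode ((LHom.sumInr : sigP →ᴸ sigS.sum sigP).onFormula
      (atomP (α := ℕ) (n.succPNat + 1))) =
      Nat.pair 2 (Nat.pair (2 * (n + 1) + 1) 0) := rfl
  rw [testFormula, formulaCode_inf, h]
  exact congrArg _ (formulaCode_onBoundedFormula_phiFixGe _)

/-- The test formula depends on `f` only through $f_1(n)$, so the answer at stage $n$ gives
$f(n+1)$, hence $f_1(n+1)$, hence the next formula. The recursion starts from $f(1)=1$. -/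
theorem not_isDecidable_combine {f : ℕ+ → Fin 2} (hf : Admissible f) :
    ¬ IsDecidable (combine (theoryF f) theoryEq) := by
  rintro ⟨d, hd, hspec⟩
  apply hf.not_computable
  have hstep : ∀ n : ℕ, d (testCode n (countVal f 1 n.succPNat + 1)) = true ↔
      f (n + 1).succPNat = 1 := fun n => by
    rw [← formulaCode_testFormula, hspec _ (isQF_testFormula _ _),
      satisfiable_testFormula_iff f hf.map_one]
    rfl
  have hdec : Computable₂ fun n c : ℕ => d (testCode n (c + 1)) :=
    hd.comp (primrec₂_testCode.to_comp.comp Computable.fst (Computable.succ.comp Computable.snd))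
  -- Written with `d` alone, so that computability is visible; `count n` turns out to be $f_1(n+1)$.
  let count : ℕ → ℕ := fun n =>
    Nat.rec 1 (fun n c => c + bif d (testCode n (c + 1)) then 1 else 0) n
  have hcount : Computable count := by
    refine Computable.nat_rec (f := fun n : ℕ => n) (g := fun _ => 1)
      (h := fun _ q => q.2 + bif d (testCode q.1 (q.2 + 1)) then 1 else 0)
      Computable.id (Computable.const 1) ?_
    exact Primrec.nat_add.to_comp.comp (Computable.snd.comp Computable.snd)
      (Computable.cond (hdec.comp (Computable.fst.comp Computable.snd)
        (Computable.snd.comp Computable.snd)) (Computable.const 1) (Computable.const 0))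
  have hcount_eq : ∀ n, count n = countVal f 1 n.succPNat := fun n => by
    induction n with
    | zero =>
      change 1 = countVal f 1 1
      rw [countVal_one, if_pos hf.map_one]
    | succ n ih =>
      change count n + (bif d (testCode n (count n + 1)) then 1 else 0) =
        countVal f 1 (n.succPNat + 1)
      rw [countVal_add_one, ih]
      congr 1
      have h := hstep n
      change _ ↔ f (n.succPNat + 1) = 1 at h
      cases hb : d (testCode n (countVal f 1 n.succPNat + 1)) <;> rw [hb] at h
      · rw [if_neg (by simpa using h)]
        rfl
      · rw [if_pos (h.1 rfl)]
        rfl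
  have hcomp : Computable fun n : ℕ =>
      (Nat.casesOn n 1 fun k => bif d (testCode k (count k + 1)) then 1 else 0 : Fin 2) :=
    Computable.nat_casesOn Computable.id (Computable.const 1)
      (Computable.cond (hdec.comp Computable.snd (hcount.comp Computable.snd))
        (Computable.const 1) (Computable.const 0))
  refine hcomp.of_eq fun n => ?_
  cases n with
  | zero => exact hf.map_one.symm
  | succ k =>
    have h := hstep k
    dsimp only
    rw [hcount_eq]
    cases hb : d (testCode k (countVal f 1 k.succPNat + 1)) <;> rw [hb] at h
    · have : f (k + 1).succPNat ≠ 1 := by simpa using h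
      rw [cond_false]
      omega
    · rw [h.1 rfl, cond_true]

end Codes

/-! ### Existence of admissible functions -/

section Existence

/-- On the `j`-th pair of consecutive numbers, the function takes the values `1, 0` if `h j` and
`0, 1` otherwise. -/
def pairing (h : ℕ → Bool) (n : ℕ+) : Fin 2 :=
  if (n.natPred % 2 == 0) == h (n.natPred / 2) then 1 else 0

/-- Each consecutive pair contributes one 0 and one 1, in either order, so every initial segment of
even length is balanced. -/
theorem countVal_pairing (h : ℕ → Bool) (i : Fin 2) (m : ℕ) :
    countVal (pairing h) i (2 * m + 1).succPNat = m + 1 := by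
  have hpair : ∀ m : ℕ,
      (if pairing h (2 * m).succPNat = i then 1 else 0) +
        (if pairing h (2 * m + 1).succPNat = i then 1 else 0) = 1 := fun m => by
    have h1 : (2 * m + 1) / 2 = m := by omega
    have h2 : (2 * m + 1) % 2 = 1 := by omega
    simp only [pairing, Nat.natPred_succPNat, Nat.mul_mod_right, h1, h2,
      Nat.mul_div_cancel_left _ (two_pos (α := ℕ))]
    cases h m <;> fin_cases i <;> rfl
  induction m with
  | zero =>
    change countVal (pairing h) i (1 + 1) = 1
    rw [countVal_add_one, countVal_one]
    exact hpair 0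
  | succ m ih =>
    change countVal (pairing h) i ((2 * m + 1).succPNat + 1 + 1) = _
    rw [countVal_add_one, countVal_add_one, ih, add_assoc]
    exact congrArg _ (hpair (m + 1))

theorem exists_admissible : ∃ f : ℕ+ → Fin 2, Admissible f := by
  classical
  -- Pair 0 is reserved to make `f 1 = 1`; pair `k + 1` records whether the program numbered `k`
  -- halts on input 0.
  let h : ℕ → Bool := fun j => Nat.casesOn j true fun k =>
    decide ((Nat.Partrec.Code.eval (Denumerable.ofNat Nat.Partrec.Code k) 0).Dom)
  refine ⟨pairing h, fun hc => ?_, rfl, fun k hk i => ?_⟩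
  · apply ComputablePred.halting_problem 0
    -- The zero-based position of the first member of the pair belonging to `c`, where the function
    -- is 1 exactly if `c` halts.
    have hmul : Primrec fun c : Nat.Partrec.Code => 2 * (Encodable.encode c + 1) :=
      Primrec.nat_mul.comp (Primrec.const 2) (Primrec.succ.comp Primrec.encode)
    have hb : Computable fun c : Nat.Partrec.Code =>
        pairing h (2 * (Encodable.encode c + 1)).succPNat == 1 :=
      Primrec.beq.to_comp.comp (hc.comp hmul.to_comp) (Computable.const 1)
    refine Computable.computablePred (hb.of_eq fun c => ?_)
    simp only [pairing, Nat.natPred_succPNat, Nat.mul_mod_right,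
      Nat.mul_div_cancel_left _ (two_pos (α := ℕ)), h, Denumerable.ofNat_encode]
    by_cases hd : (Nat.Partrec.Code.eval c 0).Dom <;> simp [hd]
  · obtain ⟨k, rfl⟩ : ∃ l, k = l + 1 := ⟨k - 1, by omega⟩
    have hpos : 0 < 2 ^ k := by positivity
    have h2 : (2 : ℕ+) ^ (k + 1) = (2 * (2 ^ k - 1) + 1).succPNat := by
      apply PNat.coe_injective
      rw [PNat.pow_coe, Nat.succPNat_coe, pow_succ]
      change 2 ^ k * 2 = _
      omega
    rw [h2, countVal_pairing, pow_succ]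
    omega

end Existence

end TheoryCombination

theorem mainTheorem2 :
    (∃ (L₁ L₂ : FirstOrder.Language.{0, 0}) (_ : EffectiveSignature L₁) (_ : EffectiveSignature L₂)
      (T₁ : L₁.Theory) (T₂ : L₂.Theory),
      IsDecidable T₁ ∧ IsDecidable T₂ ∧ StablyInfinite T₁ ∧ ¬ IsDecidable (combine T₁ T₂)) ∧
    (∃ f : ℕ+ → Fin 2, Admissible f) ∧
    IsDecidable theoryEq ∧
    ∀ f : ℕ+ → Fin 2, Admissible f →
      IsDecidable (theoryF f) ∧ StablyInfinite (theoryF f) ∧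
      (∀ n : ℕ+, Satisfiable (combine (theoryF f) theoryEq) (testFormula f n) ↔ f (n + 1) = 1) ∧
      ¬ IsDecidable (combine (theoryF f) theoryEq) := by
  obtain ⟨f, hf⟩ := exists_admissible
  exact ⟨⟨sigS, sigP, inferInstance, inferInstance, theoryF f, theoryEq, isDecidable_theoryF f,
      isDecidable_theoryEq, stablyInfinite_theoryF f, not_isDecidable_combine hf⟩, ⟨f, hf⟩,
    isDecidable_theoryEq, fun f hf => ⟨isDecidable_theoryF f, stablyInfinite_theoryF f,
      satisfiable_testFormula_iff f hf.map_one, not_isDecidable_combine hf⟩⟩
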